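/- **Notation.** All expectations are with respect to the uniform measure on $\{0,1\}^n$, $n\ge 1$. For $0\le\epsilon\le\frac12$ and $f:\{0,1\}^n\to\mathbb R$ let $f_\epsilon(x)=(T_\epsilon f)(x)=\sum_{y}\epsilon^{|y-x|}(1-\epsilon)^{n-|y-x|}f(y)$, where $|y-x|$ is the Hamming distance. For $q>1$ let $\|f\|_q=(\mathbb E|f|^q)^{1/q}$ and, for $f\ge 0$ with $\mathbb E f=1$, let $Ent_q(f)=\frac1{q-1}\log_2\|f\|_q^q$. Let $H(t)=t\log_2\frac1t+(1-t)\log_2\frac1{1-t}$, with inverse $H^{-1}:[0,1]\to[0,\frac12]$. For $0\le x\le 1$ and $0\le\epsilon\le\frac12$ put $\sigma=H^{-1}(x)$, $y=\frac{-\epsilon^2+\epsilon\sqrt{\epsilon^2+4(1-2\epsilon)\sigma(1-\sigma)}}{2(1-2\epsilon)}$ (with $y=\sigma(1-\sigma)$, its limit, if $\epsilon=\frac12$), and $$\Phi(x,\epsilon)=\tfrac12\Big(x-1+\sigma H\big(\tfrac y\sigma\big)+(1-\sigma)H\big(\tfrac y{1-\sigma}\big)+2y\log_2\epsilon+(1-2y)\log_2(1-\epsilon)\Big)$$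 (where $\sigma H(y/\sigma)=0$ if $\sigma=0$, and $2y\log_2\epsilon=0$ if $\epsilon=0$). Let $\phi_\epsilon(x)=\Phi(x,2\epsilon(1-\epsilon))$ on $[0,1]$; derivatives at the end points are one-sided. For $q>1$ define $$\psi_{2,q}(x,\epsilon)=2\cdot\begin{cases}\frac{q-1}q\,x+\phi_\epsilon(\alpha_0)+\frac{1-\alpha_0}q & \text{if }\phi_\epsilon'(1-x)<\frac1q,\\ \phi_\epsilon(1-x)+x&\text{otherwise,}\end{cases}$$ where $\alpha_0=(\phi_\epsilon')^{-1}(1/q)\in[0,1]$ if $\epsilon>0$, and $\alpha_0=0$ if $\epsilon=0$. **Proposition 1.1.** Let $q>1$. 1. $\psi_{2,q}$ is well defined on $[0,1]\times[0,\frac12]$: $\phi_\epsilon$ is differentiable on $[0,1]$, and if $0<\epsilon\le\frac12$, $0\le x\le1$ and $\phi'_\epsilon(1-x)<\frac1q$, there is a unique $\alpha_0\in[0,1]$ with $\phi_\epsilon'(\alpha_0)=\frac1q$. For each $0\le\epsilon\le\frac12$ the function $\psi_{2,q}(\cdot,\epsilon)$ is nondecreasing and concave on $[0,1]$, and it is strictly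 increasing if $\epsilon<\frac12$. 2. For all $0\le\epsilon\le\frac12$, all $n\ge1$ and every $f:\{0,1\}^n\to[0,\infty)$ with $\mathbb E f=1$, we have $\frac{Ent_q(f)}n\in[0,1]$ and $$\frac{Ent_2(f_\epsilon)}n\le\psi_{2,q}\Big(\frac{Ent_q(f)}n,\epsilon\Big).$$ 3. This is essentially tight: for all $0<x<1$, $0<\epsilon<\frac12$ and $y<\psi_{2,q}(x,\epsilon)$ there exist arbitrarily large $n$ and functions $f\ge0$ on $\{0,1\}^n$ with $\mathbb E f=1$, $\frac{Ent_q(f)}n\le x$ and $\frac{Ent_2(f_\epsilon)}n>y$. Moreover $f$ can be taken to be a convex combination $f=(1-\lambda)\cdot 1+\lambda\cdot\frac{2^n}{|S|}1_S$, $0\le\lambda\le1$, of the densities of the uniform distributions on $\{0,1\}^n$ and on a Hamming sphere $S$ around $0$. -/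

import Mathlib

open Set

noncomputable section

namespace MrsGerber

/-- The boolean cube `{0,1}^n`. -/
abbrev Cube (n : ℕ) : Type := Fin n → Bool

/-- Expectation with respect to the uniform measure on the cube. -/
def mean {n : ℕ} (f : Cube n → ℝ) : ℝ := (∑ z, f z) / 2 ^ n

/-- The noise operator `T_ε`; `hammingDist` is the Hamming distance `|y - x|`. -/
def noise {n : ℕ} (ε : ℝ) (f : Cube n → ℝ) : Cube n → ℝ := fun x =>
  ∑ y, ε ^ hammingDist y x * (1 - ε) ^ (n - hammingDist y x) * f y

/-- The norm `‖f‖_q = (E |f|^q)^{1/q}`. -/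
def lqNorm {n : ℕ} (q : ℝ) (f : Cube n → ℝ) : ℝ := (mean fun z => |f z| ^ q) ^ (1 / q)

/-- The `q`-th Rényi entropy `Ent_q(f) = (1/(q-1)) log₂ ‖f‖_q^q` (for `f ≥ 0` with `E f = 1`). -/
def renyiEnt {n : ℕ} (q : ℝ) (f : Cube n → ℝ) : ℝ :=
  1 / (q - 1) * Real.logb 2 (lqNorm q f ^ q)

/-- The Hamming sphere of radius `r` around `c`. -/
def hammingSphere {n : ℕ} (c : Cube n) (r : ℕ) : Finset (Cube n) :=
  Finset.univ.filter fun y => hammingDist y c = r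

/-- The convex combination, with weight `l` on the sphere, of the density of the uniform
distribution on the cube (the constant `1`) and the density of the uniform distribution on the
Hamming sphere of radius `r` around `0` (the normalized indicator, of expectation `1`). -/
def sphereMix (n r : ℕ) (l : ℝ) : Cube n → ℝ := fun z =>
  (1 - l) * 1 +
    l * ((2 ^ n / ((hammingSphere (fun _ => false : Cube n) r).card : ℝ)) *
      (hammingSphere (fun _ => false : Cube n) r : Set (Cube n)).indicator 1 z)

/-- The binary entropy function in bits, `H(t) = t log₂(1/t) + (1-t) log₂(1/(1-t))`. -/
def H (t : ℝ) : ℝ := Real.binEntropy t / Real.log 2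

/-- The inverse of the bijection `H : [0,1/2] → [0,1]`. -/
def Hinv (x : ℝ) : ℝ := Function.invFunOn H (Icc 0 (1 / 2)) x

/-- The auxiliary quantity `y(x, ε)`; at `ε = 1/2`, where the closed formula reads `0/0`, it is
given its limiting value `σ (1-σ)`. -/
def yAux (x ε : ℝ) : ℝ :=
  if ε = 1 / 2 then Hinv x * (1 - Hinv x)
  else (-ε ^ 2 + ε * √(ε ^ 2 + 4 * (1 - 2 * ε) * Hinv x * (1 - Hinv x))) / (2 * (1 - 2 * ε))

/-- The function `Φ(x, ε)` on `[0,1] × [0,1/2]`. The conventions `0 · H(0/0) = 0` at `x = 0` and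
`0 · log₂ 0 = 0` at `ε = 0` are built into Lean's arithmetic. -/
def Phi (x ε : ℝ) : ℝ :=
  1 / 2 * (x - 1 + Hinv x * H (yAux x ε / Hinv x) + (1 - Hinv x) * H (yAux x ε / (1 - Hinv x))
    + 2 * yAux x ε * Real.logb 2 ε + (1 - 2 * yAux x ε) * Real.logb 2 (1 - ε))

/-- `φ_ε(x) = Φ(x, 2ε(1-ε))`, a function on `[0,1]`. -/
def phi (ε x : ℝ) : ℝ := Phi x (2 * ε * (1 - ε))

/-- The derivative of `φ_ε` on `[0,1]`, one-sided at the end points. -/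
def phi' (ε x : ℝ) : ℝ := derivWithin (phi ε) (Icc 0 1) x

/-- `α₀ = (φ_ε')⁻¹(1/q)`. For `ε = 0` the derivative is the constant `1/2`, and the value is the
limit as `ε → 0`, namely `0` (it is used in `psi` only when `1/2 < 1/q`); it is the point where
`φ_0(α) - α/q` is maximal on `[0,1]`. -/
def alpha0 (q ε : ℝ) : ℝ :=
  if ε = 0 then 0 else Function.invFunOn (phi' ε) (Icc 0 1) (1 / q)

open Classical in
/-- The function `ψ_{2,q}(x, ε)` on `[0,1] × [0,1/2]`. -/
def psi (q x ε : ℝ) : ℝ :=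
  2 * (if phi' ε (1 - x) < 1 / q then
      (q - 1) / q * x + (phi ε (alpha0 q ε) + (1 - alpha0 q ε) / q)
    else phi ε (1 - x) + x)

end MrsGerber

end

namespace MrsGerber

open Real Filter Topology

/-! ### The binary entropy function and its inverse -/

lemma log_two_pos : 0 < Real.log 2 := Real.log_pos one_lt_two

lemma H_zero : H 0 = 0 := by simp [H]

lemma H_half : H (1 / 2) = 1 := by
  rw [H, one_div, binEntropy_two_inv, div_self log_two_pos.ne']

lemma H_mul_log_two (t : ℝ) : H t * Real.log 2 = negMulLog t + negMulLog (1 - t) := by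
  rw [H, div_mul_cancel₀ _ log_two_pos.ne', binEntropy_eq_negMulLog_add_negMulLog_one_sub]

lemma continuous_H : Continuous H := binEntropy_continuous.div_const _

lemma H_strictMonoOn : StrictMonoOn H (Icc 0 (1 / 2)) := by
  intro a ha b hb hab
  rw [one_div] at ha hb
  exact div_lt_div_of_pos_right (binEntropy_strictMonoOn ha hb hab) log_two_pos

lemma H_mapsTo : MapsTo H (Icc 0 (1 / 2)) (Icc 0 1) := by
  intro a ha
  rw [← H_zero, ← H_half]
  exact ⟨H_strictMonoOn.monotoneOn ⟨le_rfl, by norm_num⟩ ha ha.1,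
    H_strictMonoOn.monotoneOn ha ⟨by norm_num, le_rfl⟩ ha.2⟩

lemma H_surjOn : SurjOn H (Icc 0 (1 / 2)) (Icc 0 1) := by
  have h := intermediate_value_Icc (by norm_num : (0 : ℝ) ≤ 1 / 2) continuous_H.continuousOn
  rwa [H_zero, H_half] at h

lemma Hinv_mem {x : ℝ} (hx : x ∈ Icc (0 : ℝ) 1) : Hinv x ∈ Icc (0 : ℝ) (1 / 2) :=
  Function.invFunOn_mem (H_surjOn hx)

lemma H_Hinv {x : ℝ} (hx : x ∈ Icc (0 : ℝ) 1) : H (Hinv x) = x :=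
  Function.invFunOn_eq (H_surjOn hx)

lemma Hinv_H {s : ℝ} (hs : s ∈ Icc (0 : ℝ) (1 / 2)) : Hinv (H s) = s :=
  H_strictMonoOn.injOn (Hinv_mem (H_mapsTo hs)) hs (H_Hinv (H_mapsTo hs))

lemma Hinv_zero : Hinv 0 = 0 := by
  have := Hinv_H (s := 0) ⟨le_rfl, by norm_num⟩
  rwa [H_zero] at this

lemma Hinv_one : Hinv 1 = 1 / 2 := by
  have := Hinv_H (s := 1 / 2) ⟨by norm_num, le_rfl⟩
  rwa [H_half] at this

lemma Hinv_strictMonoOn : StrictMonoOn Hinv (Icc 0 1) := by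
  intro a ha b hb hab
  rw [← H_strictMonoOn.lt_iff_lt (Hinv_mem ha) (Hinv_mem hb), H_Hinv ha, H_Hinv hb]
  exact hab

lemma Hinv_mem_Ioo {x : ℝ} (hx : x ∈ Ioo (0 : ℝ) 1) : Hinv x ∈ Ioo (0 : ℝ) (1 / 2) := by
  have h0 := Hinv_strictMonoOn ⟨le_rfl, zero_le_one⟩ (Ioo_subset_Icc_self hx) hx.1
  have h1 := Hinv_strictMonoOn (Ioo_subset_Icc_self hx) ⟨zero_le_one, le_rfl⟩ hx.2
  rw [Hinv_zero] at h0
  rw [Hinv_one] at h1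
  exact ⟨h0, h1⟩

lemma continuousOn_Hinv : ContinuousOn Hinv (Icc 0 1) := by
  have hmono : StrictMono (H_mapsTo.restrict H (Icc 0 (1 / 2)) (Icc 0 1)) :=
    fun a b hab => H_strictMonoOn a.2 b.2 hab
  have hsurj : Function.Surjective (H_mapsTo.restrict H (Icc 0 (1 / 2)) (Icc 0 1)) :=
    fun b => ⟨⟨Hinv b, Hinv_mem b.2⟩, Subtype.ext (H_Hinv b.2)⟩
  let e := hmono.orderIsoOfSurjective _ hsurj
  rw [continuousOn_iff_continuous_domRestrict]
  have h : (Icc (0 : ℝ) 1).domRestrict Hinv = fun x => (e.symm x : ℝ) := by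
    funext x
    have hx : e ⟨Hinv x, Hinv_mem x.2⟩ = x := Subtype.ext (H_Hinv x.2)
    conv_rhs => rw [← hx, e.symm_apply_apply]
    rfl
  rw [h]
  exact continuous_subtype_val.comp e.symm.continuous

lemma hasDerivAt_Hinv {x : ℝ} (hx : x ∈ Ioo (0 : ℝ) 1) :
    HasDerivAt Hinv (Real.log 2 / (Real.log (1 - Hinv x) - Real.log (Hinv x))) x := by
  have hs := Hinv_mem_Ioo hx
  have hpos : 0 < Real.log (1 - Hinv x) - Real.log (Hinv x) :=
    sub_pos.2 (Real.log_lt_log hs.1 (by linarith [hs.2]))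
  have hH : HasDerivAt H ((Real.log (1 - Hinv x) - Real.log (Hinv x)) / Real.log 2) (Hinv x) :=
    (hasDerivAt_binEntropy hs.1.ne' (by linarith [hs.2])).div_const _
  have h := HasDerivAt.of_local_left_inverse
    (continuousOn_Hinv.continuousAt (Icc_mem_nhds hx.1 hx.2)) hH
    (div_pos hpos log_two_pos).ne' (by
      filter_upwards [Icc_mem_nhds hx.1 hx.2] with z hz using H_Hinv hz)
  rwa [inv_div] at h

/-! ### The exponent `Φ` in terms of the joint type of a pair of points -/

/-- The quantity `y` as a function of `σ = H⁻¹(x)`. -/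
noncomputable def overlap (δ s : ℝ) : ℝ :=
  if δ = 1 / 2 then s * (1 - s)
  else (-δ ^ 2 + δ * √(δ ^ 2 + 4 * (1 - 2 * δ) * s * (1 - s))) / (2 * (1 - 2 * δ))

lemma yAux_eq (x δ : ℝ) : yAux x δ = overlap δ (Hinv x) := rfl

lemma overlap_eq_of_quadratic {δ s y : ℝ} (hδ : δ ∈ Icc (0 : ℝ) (1 / 2)) (hy : 0 ≤ y)
    (h : (1 - 2 * δ) * y ^ 2 + δ ^ 2 * y = δ ^ 2 * (s * (1 - s))) : overlap δ s = y := by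
  rw [overlap]
  split_ifs with hh
  · subst hh
    linarith
  · have h1 : 0 < 1 - 2 * δ := by
      have := lt_of_le_of_ne hδ.2 hh
      linarith
    rcases hδ.1.eq_or_lt with h0 | h0
    · subst h0
      have : y = 0 := by
        have : y ^ 2 = 0 := by linarith
        exact pow_eq_zero_iff two_ne_zero |>.1 this
      simp [this]
    · have h2 : √(δ ^ 2 + 4 * (1 - 2 * δ) * s * (1 - s)) = (2 * (1 - 2 * δ) * y + δ ^ 2) / δ := by
        rw [Real.sqrt_eq_iff_eq_sq _ (by positivity)]
        · field_simp
          linear_combination (-4 * (1 - 2 * δ)) * h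
        · have : δ ^ 2 * (δ ^ 2 + 4 * (1 - 2 * δ) * s * (1 - s)) =
              (2 * (1 - 2 * δ) * y + δ ^ 2) ^ 2 := by
            linear_combination (-4 * (1 - 2 * δ)) * h
          exact (mul_nonneg_iff_of_pos_left (pow_pos h0 2)).1 (this ▸ sq_nonneg _)
      have h3 : 1 - 2 * δ ≠ 0 := h1.ne'
      rw [h2, mul_div_cancel₀ _ h0.ne', div_eq_iff (by positivity)]
      ring

lemma overlap_quadratic {δ s : ℝ} (hδ : δ ∈ Icc (0 : ℝ) (1 / 2)) (hs : s ∈ Icc (0 : ℝ) 1) :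
    (1 - 2 * δ) * overlap δ s ^ 2 + δ ^ 2 * overlap δ s = δ ^ 2 * (s * (1 - s)) := by
  rw [overlap]
  split_ifs with hh
  · subst hh
    ring
  · have h1 : 0 < 1 - 2 * δ := by
      have := lt_of_le_of_ne hδ.2 hh
      linarith
    have hs0 : 0 ≤ s * (1 - s) := mul_nonneg hs.1 (by linarith [hs.2])
    have hD : 0 ≤ δ ^ 2 + 4 * (1 - 2 * δ) * s * (1 - s) := by nlinarith [sq_nonneg δ]
    have hsq := Real.sq_sqrt hD
    set w := √(δ ^ 2 + 4 * (1 - 2 * δ) * s * (1 - s))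
    field_simp
    linear_combination (δ ^ 2) * hsq

lemma overlap_nonneg {δ s : ℝ} (hδ : δ ∈ Icc (0 : ℝ) (1 / 2)) (hs : s ∈ Icc (0 : ℝ) 1) :
    0 ≤ overlap δ s := by
  have hs0 : 0 ≤ s * (1 - s) := mul_nonneg hs.1 (by linarith [hs.2])
  rw [overlap]
  split_ifs with hh
  · exact hs0
  · have h1 : 0 < 1 - 2 * δ := by
      have := lt_of_le_of_ne hδ.2 hh
      linarith
    have hw : δ ≤ √(δ ^ 2 + 4 * (1 - 2 * δ) * s * (1 - s)) :=
      Real.le_sqrt_of_sq_le (by nlinarith)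
    have := mul_le_mul_of_nonneg_left hw hδ.1
    apply div_nonneg <;> nlinarith

lemma overlap_le {δ s : ℝ} (hδ : δ ∈ Icc (0 : ℝ) (1 / 2)) (hs : s ∈ Icc (0 : ℝ) (1 / 2)) :
    overlap δ s ≤ s := by
  have hs' : s ∈ Icc (0 : ℝ) 1 := ⟨hs.1, by linarith [hs.2]⟩
  have h0 := overlap_nonneg hδ hs'
  have hq := overlap_quadratic hδ hs'
  by_contra! hlt
  have hδ0 : 0 < 1 - δ := by linarith [hδ.2]
  have h3 : (1 - δ) ^ 2 * overlap δ s ^ 2 = δ ^ 2 * ((s - overlap δ s) * (1 - s - overlap δ s)) := by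
    linear_combination hq
  have h4 : (0 : ℝ) < (1 - δ) ^ 2 * overlap δ s ^ 2 := by
    have := lt_of_le_of_lt hs.1 hlt
    positivity
  rcases le_or_gt (overlap δ s) (1 - s) with h5 | h5
  · have := mul_nonneg (sub_nonneg.2 hlt.le) (sub_nonneg.2 h5)
    nlinarith [mul_nonneg (sq_nonneg δ) this]
  · have h6 : (s - overlap δ s) * (1 - s - overlap δ s) < overlap δ s ^ 2 := by nlinarith [hs.2]
    have h7 : δ ^ 2 ≤ (1 - δ) ^ 2 := by nlinarith [hδ.1, hδ.2]
    have h8 : 0 ≤ (s - overlap δ s) * (1 - s - overlap δ s) := by nlinarith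
    have h9 := mul_le_mul_of_nonneg_right h7 h8
    have h10 := mul_lt_mul_of_pos_left h6 (pow_pos hδ0 2)
    linarith

lemma mul_binEntropy_div {s y : ℝ} (h : s = 0 → y = 0) :
    s * binEntropy (y / s) = negMulLog y + negMulLog (s - y) - negMulLog s := by
  rcases eq_or_ne s 0 with hs | hs
  · simp [hs, h hs]
  · have h1 := negMulLog_mul s (y / s)
    have h2 := negMulLog_mul s (1 - y / s)
    rw [mul_div_cancel₀ _ hs] at h1
    rw [mul_sub, mul_one, mul_div_cancel₀ _ hs] at h2
    rw [binEntropy_eq_negMulLog_add_negMulLog_one_sub, h1, h2]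
    ring

/-- The exponent, in nats, of the contribution to the noise stability of the pairs of points
of joint type `(s - y, y, y, 1 - s - y)`, shifted by the dimension. -/
noncomputable def pairExponent (δ s y : ℝ) : ℝ :=
  2 * negMulLog y + negMulLog (s - y) + negMulLog (1 - s - y) +
    2 * y * Real.log δ + (1 - 2 * y) * Real.log (1 - δ)

lemma Phi_eq {δ x : ℝ} (hδ : δ ∈ Icc (0 : ℝ) (1 / 2)) (hx : x ∈ Icc (0 : ℝ) 1) :
    2 * Real.log 2 * Phi x δ =
      pairExponent δ (Hinv x) (overlap δ (Hinv x)) - Real.log 2 := by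
  have hs := Hinv_mem hx
  have h0 : Hinv x = 0 → overlap δ (Hinv x) = 0 := fun h =>
    le_antisymm (h ▸ overlap_le hδ (h ▸ hs)) (overlap_nonneg hδ ⟨hs.1, by linarith [hs.2]⟩)
  have h1 : 1 - Hinv x = 0 → overlap δ (Hinv x) = 0 := fun h => by linarith [hs.2]
  have e1 := mul_binEntropy_div h0
  have e2 := mul_binEntropy_div h1
  have e3 := H_mul_log_two (Hinv x)
  rw [H_Hinv hx] at e3
  have hl := log_two_pos.ne'
  rw [Phi, pairExponent, yAux_eq, H, H, Real.logb, Real.logb]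
  field_simp
  linear_combination e1 + e2 + e3

/-! ### The two-point inequality -/

lemma pairExponent_gibbs {δ a b Z s y : ℝ} (hδ : δ ∈ Icc (0 : ℝ) (1 / 2)) (ha : 0 < a) (hb : 0 ≤ b)
    (hZ : Z = (1 - δ) * (a ^ 2 + b ^ 2) + 2 * δ * (a * b))
    (hs : s = ((1 - δ) * b ^ 2 + δ * (a * b)) / Z) (hy : y = δ * (a * b) / Z) :
    pairExponent δ s y = Real.log Z - 2 * ((1 - s) * Real.log a) - 2 * (s * Real.log b) := by
  have hδ1 : 0 < 1 - δ := by linarith [hδ.2]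
  have hZ0 : 0 < Z := by
    have := hδ.1
    rw [hZ]; positivity
  have e1 : s - y = (1 - δ) * b ^ 2 / Z := by rw [hs, hy]; ring
  have e2 : 1 - s - y = (1 - δ) * a ^ 2 / Z := by
    rw [hs, hy]; field_simp; rw [hZ]; ring
  have l2 : negMulLog (1 - s - y) =
      -(1 - s - y) * (Real.log (1 - δ) + 2 * Real.log a - Real.log Z) := by
    rw [negMulLog, e2, Real.log_div (by positivity) hZ0.ne',
      Real.log_mul hδ1.ne' (by positivity), Real.log_pow]
    push_cast; ring
  have l1 : negMulLog (s - y) = -(s - y) * (Real.log (1 - δ) + 2 * Real.log b - Real.log Z) := by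
    rcases hb.eq_or_lt with h | h
    · rw [e1, ← h]; simp
    · rw [negMulLog, e1, Real.log_div (by positivity) hZ0.ne',
        Real.log_mul hδ1.ne' (by positivity), Real.log_pow]
      push_cast; ring
  have l3 : negMulLog y = -y * (Real.log δ + Real.log a + Real.log b - Real.log Z) := by
    rcases hb.eq_or_lt with h | h
    · rw [hy, ← h]; simp
    · rcases hδ.1.eq_or_lt with h' | h'
      · rw [hy, ← h']; simp
      · rw [negMulLog, hy, Real.log_div (by positivity) hZ0.ne',
          Real.log_mul h'.ne' (by positivity), Real.log_mul ha.ne' h.ne']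
        ring
  rw [pairExponent, l1, l2, l3]
  ring

lemma overlap_gibbs {δ a b Z : ℝ} (hδ : δ ∈ Icc (0 : ℝ) (1 / 2)) (ha : 0 < a) (hb : 0 ≤ b)
    (hZ : Z = (1 - δ) * (a ^ 2 + b ^ 2) + 2 * δ * (a * b)) :
    overlap δ (((1 - δ) * b ^ 2 + δ * (a * b)) / Z) = δ * (a * b) / Z := by
  have hδ1 : 0 < 1 - δ := by linarith [hδ.2]
  have hδ0 := hδ.1
  have hZ0 : 0 < Z := by rw [hZ]; positivity
  refine overlap_eq_of_quadratic hδ (by positivity) ?_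
  field_simp
  rw [hZ]
  ring

lemma negMulLog_add_mul_log_le {u v S : ℝ} (hu : 0 ≤ u) (hv : 0 ≤ v) (hS : 0 < S)
    (h : v = 0 → u = 0) : negMulLog u + u * Real.log v ≤ u * Real.log S + v / S - u := by
  rcases hu.eq_or_lt with rfl | hu'
  · simp only [negMulLog_zero, zero_mul, zero_add, sub_zero]
    positivity
  · have hv' : 0 < v := lt_of_le_of_ne hv fun h' => hu'.ne' (h h'.symm)
    have h1 := Real.log_le_sub_one_of_pos (show 0 < v / (u * S) by positivity)
    rw [Real.log_div hv'.ne' (by positivity), Real.log_mul hu'.ne' hS.ne'] at h1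
    have h2 := mul_le_mul_of_nonneg_left h1 hu
    have h3 : u * (v / (u * S) - 1) = v / S - u := by field_simp
    rw [h3] at h2
    rw [negMulLog]
    linarith

lemma two_point {δ a b p : ℝ} (hδ : δ ∈ Icc (0 : ℝ) (1 / 2)) (hb : 0 ≤ b) (hab : b ≤ a)
    (ha : 0 < a) (hp : 0 < p) :
    ∃ x ∈ Icc (0 : ℝ) 1, Real.log ((1 - δ) * (a ^ 2 + b ^ 2) + 2 * δ * (a * b)) ≤
      2 * Real.log 2 * Phi x δ + Real.log 2 + 2 / p * Real.log (a ^ p + b ^ p) -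
        2 / p * (x * Real.log 2) := by
  obtain ⟨Z, hZ⟩ : ∃ Z, Z = (1 - δ) * (a ^ 2 + b ^ 2) + 2 * δ * (a * b) := ⟨_, rfl⟩
  obtain ⟨s, hs⟩ : ∃ s, s = ((1 - δ) * b ^ 2 + δ * (a * b)) / Z := ⟨_, rfl⟩
  have hδ1 : 0 < 1 - δ := by linarith [hδ.2]
  have hδ0 := hδ.1
  have hZ0 : 0 < Z := by rw [hZ]; positivity
  have hs0 : 0 ≤ s := by rw [hs]; positivity
  have hs1 : s ≤ 1 / 2 := by
    rw [hs, div_le_iff₀ hZ0, hZ]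
    have : b ^ 2 ≤ a ^ 2 := pow_le_pow_left₀ hb hab 2
    nlinarith
  have hx := H_mapsTo (x := s) ⟨hs0, hs1⟩
  refine ⟨H s, hx, ?_⟩
  have hP := Phi_eq hδ hx
  have hov := overlap_gibbs hδ ha hb hZ
  rw [← hs] at hov
  rw [Hinv_H ⟨hs0, hs1⟩, hov, pairExponent_gibbs hδ ha hb hZ hs rfl] at hP
  have hap : 0 < a ^ p := Real.rpow_pos_of_pos ha p
  have hbp : 0 ≤ b ^ p := Real.rpow_nonneg hb p
  have hS : 0 < a ^ p + b ^ p := by positivity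
  have k1 := negMulLog_add_mul_log_le (u := 1 - s) (by linarith) hap.le hS
    (fun h => absurd h hap.ne')
  have k2 := negMulLog_add_mul_log_le hs0 hbp hS (fun h => by
    have : b = 0 := (Real.rpow_eq_zero hb hp.ne').1 h
    rw [hs, this]; simp)
  have k3 : a ^ p / (a ^ p + b ^ p) + b ^ p / (a ^ p + b ^ p) = 1 := by field_simp
  have k4 : s * Real.log (b ^ p) = p * (s * Real.log b) := by
    rcases hb.eq_or_lt with h | h
    · have : s = 0 := by rw [hs, ← h]; simp
      simp [this]
    · rw [Real.log_rpow h]; ring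
  rw [Real.log_rpow ha] at k1
  rw [k4] at k2
  have hH := H_mul_log_two s
  rw [← hZ, hH]
  have k5 : (1 - s) * Real.log a + s * Real.log b ≤
      1 / p * (Real.log (a ^ p + b ^ p) - (negMulLog s + negMulLog (1 - s))) := by
    rw [one_div, inv_mul_eq_div, le_div_iff₀ hp]
    linarith
  have k6 : 2 / p * Real.log (a ^ p + b ^ p) - 2 / p * (negMulLog s + negMulLog (1 - s)) =
    2 * (1 / p * (Real.log (a ^ p + b ^ p) - (negMulLog s + negMulLog (1 - s)))) := by ring
  linarith

/-! ### The derivative of `Φ` -/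

lemma overlap_pos {δ s : ℝ} (hδ : δ ∈ Ioo (0 : ℝ) (1 / 2)) (hs : s ∈ Ioc (0 : ℝ) (1 / 2)) :
    0 < overlap δ s := by
  have hs' : s ∈ Icc (0 : ℝ) 1 := ⟨hs.1.le, by linarith [hs.2]⟩
  refine lt_of_le_of_ne (overlap_nonneg (Ioo_subset_Icc_self hδ) hs') fun h => ?_
  have hq := overlap_quadratic (Ioo_subset_Icc_self hδ) hs'
  rw [← h] at hq
  have : 0 < δ ^ 2 * (s * (1 - s)) :=
    mul_pos (pow_pos hδ.1 2) (mul_pos hs.1 (by linarith [hs.2]))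
  linarith

lemma overlap_lt {δ s : ℝ} (hδ : δ ∈ Ioo (0 : ℝ) (1 / 2)) (hs : s ∈ Ioc (0 : ℝ) (1 / 2)) :
    overlap δ s < s := by
  have hs' : s ∈ Icc (0 : ℝ) 1 := ⟨hs.1.le, by linarith [hs.2]⟩
  refine lt_of_le_of_ne (overlap_le (Ioo_subset_Icc_self hδ) ⟨hs.1.le, hs.2⟩) fun h => ?_
  have hq := overlap_quadratic (Ioo_subset_Icc_self hδ) hs'
  rw [h] at hq
  have : 0 < (1 - δ) ^ 2 * s ^ 2 :=
    mul_pos (pow_pos (by linarith [hδ.2]) 2) (pow_pos hs.1 2)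
  nlinarith

/-- Half the log-odds of the pair `(0,0)` against the pair `(1,1)` in the optimal joint type. -/
noncomputable def dualVar (δ s : ℝ) : ℝ :=
  (Real.log (1 - s - overlap δ s) - Real.log (s - overlap δ s)) / 2

/-- The difference between the marginal log-odds and `t` for the weights `(e ^ t, 1)`. -/
noncomputable def oddsShift (δ t : ℝ) : ℝ :=
  Real.log ((1 - δ) * Real.exp t + δ) - Real.log ((1 - δ) + δ * Real.exp t)

lemma dualVar_pos {δ s : ℝ} (hδ : δ ∈ Ioo (0 : ℝ) (1 / 2)) (hs : s ∈ Ioo (0 : ℝ) (1 / 2)) :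
    0 < dualVar δ s := by
  have h := overlap_lt hδ ⟨hs.1, hs.2.le⟩
  have := Real.log_lt_log (sub_pos.2 h)
    (show s - overlap δ s < 1 - s - overlap δ s by linarith [hs.2])
  rw [dualVar]
  linarith

lemma optimal_type {δ s : ℝ} (hδ : δ ∈ Ioo (0 : ℝ) (1 / 2)) (hs : s ∈ Ioc (0 : ℝ) (1 / 2)) :
    1 - s - overlap δ s = (s - overlap δ s) * Real.exp (dualVar δ s) ^ 2 ∧
    (1 - δ) * overlap δ s = δ * ((s - overlap δ s) * Real.exp (dualVar δ s)) := by
  have hp := sub_pos.2 (overlap_lt hδ hs)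
  have hy := overlap_pos hδ hs
  have hq := overlap_quadratic (Ioo_subset_Icc_self hδ) ⟨hs.1.le, show s ≤ 1 by linarith [hs.2]⟩
  have hr : 0 < 1 - s - overlap δ s := by linarith [hs.2]
  have h1 : 1 - s - overlap δ s = (s - overlap δ s) * Real.exp (dualVar δ s) ^ 2 := by
    rw [← Real.exp_nat_mul, dualVar]
    push_cast
    rw [mul_div_cancel₀ _ (two_ne_zero), Real.exp_sub, Real.exp_log hr, Real.exp_log hp,
      mul_div_cancel₀ _ hp.ne']
  refine ⟨h1, ?_⟩
  have h2 : ((1 - δ) * overlap δ s) ^ 2 =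
      (δ * ((s - overlap δ s) * Real.exp (dualVar δ s))) ^ 2 := by
    have : (δ * ((s - overlap δ s) * Real.exp (dualVar δ s))) ^ 2 =
        δ ^ 2 * ((s - overlap δ s) * (1 - s - overlap δ s)) := by rw [h1]; ring
    rw [this]
    linear_combination hq
  have h3 : 0 < 1 - δ := by linarith [hδ.2]
  have h4 := hδ.1
  exact (pow_left_inj₀ (by positivity) (by positivity) two_ne_zero).1 h2

lemma log_odds {δ s : ℝ} (hδ : δ ∈ Ioo (0 : ℝ) (1 / 2)) (hs : s ∈ Ioc (0 : ℝ) (1 / 2)) :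
    Real.log (1 - s) - Real.log s = dualVar δ s + oddsShift δ (dualVar δ s) := by
  obtain ⟨h1, h2⟩ := optimal_type hδ hs
  have hp := sub_pos.2 (overlap_lt hδ hs)
  have h3 : 0 < 1 - δ := by linarith [hδ.2]
  have h4 := hδ.1
  set p := s - overlap δ s with hpdef
  set R := Real.exp (dualVar δ s) with hR
  have hR0 : 0 < R := Real.exp_pos _
  have e1 : (1 - δ) * s = p * ((1 - δ) + δ * R) := by
    have : s = p + overlap δ s := by rw [hpdef]; ring
    rw [this]; linear_combination h2
  have e2 : (1 - δ) * (1 - s) = p * (R * ((1 - δ) * R + δ)) := by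
    linear_combination h2 + (1 - δ) * h1
  have l1 := congrArg Real.log e1
  have l2 := congrArg Real.log e2
  rw [Real.log_mul h3.ne' hs.1.ne', Real.log_mul hp.ne' (by positivity)] at l1
  rw [Real.log_mul h3.ne' (by linarith [hs.2]), Real.log_mul hp.ne' (by positivity),
    Real.log_mul hR0.ne' (by positivity)] at l2
  have : Real.log R = dualVar δ s := Real.log_exp _
  rw [oddsShift, ← hR]
  linarith

lemma oddsShift_zero (δ : ℝ) : oddsShift δ 0 = 0 := by simp [oddsShift]

lemma hasDerivAt_oddsShift {δ : ℝ} (hδ : δ ∈ Ioo (0 : ℝ) (1 / 2)) (t : ℝ) :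
    HasDerivAt (oddsShift δ) ((1 - 2 * δ) * Real.exp t /
      (((1 - δ) + δ * Real.exp t) * ((1 - δ) * Real.exp t + δ))) t := by
  have h3 : 0 < 1 - δ := by linarith [hδ.2]
  have h4 := hδ.1
  have hE := Real.exp_pos t
  have d1 : HasDerivAt (fun t => (1 - δ) * Real.exp t + δ) ((1 - δ) * Real.exp t) t :=
    ((Real.hasDerivAt_exp t).const_mul _).add_const _
  have d2 : HasDerivAt (fun t => (1 - δ) + δ * Real.exp t) (δ * Real.exp t) t :=
    ((Real.hasDerivAt_exp t).const_mul _).const_add _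
  have h := (d1.log (by positivity)).sub (d2.log (by positivity))
  refine h.congr_deriv ?_
  have n1 : (1 - δ) * Real.exp t + δ ≠ 0 := by positivity
  have n2 : (1 - δ) + δ * Real.exp t ≠ 0 := by positivity
  rw [div_sub_div _ _ n1 n2, div_eq_div_iff (mul_ne_zero n1 n2) (mul_ne_zero n2 n1)]
  ring

lemma continuous_oddsShift {δ : ℝ} (hδ : δ ∈ Ioo (0 : ℝ) (1 / 2)) : Continuous (oddsShift δ) :=
  continuous_iff_continuousAt.2 fun t => (hasDerivAt_oddsShift hδ t).continuousAt

lemma oddsShift_strictMono {δ : ℝ} (hδ : δ ∈ Ioo (0 : ℝ) (1 / 2)) : StrictMono (oddsShift δ) := by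
  refine strictMono_of_deriv_pos fun t => ?_
  rw [(hasDerivAt_oddsShift hδ t).deriv]
  have h3 : 0 < 1 - δ := by linarith [hδ.2]
  have h4 := hδ.1
  have h5 : 0 < 1 - 2 * δ := by linarith [hδ.2]
  positivity

lemma oddsShift_strictConcaveOn {δ : ℝ} (hδ : δ ∈ Ioo (0 : ℝ) (1 / 2)) :
    StrictConcaveOn ℝ (Ici 0) (oddsShift δ) := by
  refine StrictAntiOn.strictConcaveOn_of_deriv (convex_Ici 0)
    (continuous_oddsShift hδ).continuousOn ?_
  rw [interior_Ici]
  intro t₁ h₁ t₂ h₂ hlt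
  rw [(hasDerivAt_oddsShift hδ _).deriv, (hasDerivAt_oddsShift hδ _).deriv]
  have h3 : 0 < 1 - δ := by linarith [hδ.2]
  have h4 := hδ.1
  have h5 : 0 < 1 - 2 * δ := by linarith [hδ.2]
  have hE1 : 1 < Real.exp t₁ := Real.one_lt_exp_iff.2 h₁
  have hE := Real.exp_lt_exp.2 hlt
  set E₁ := Real.exp t₁
  set E₂ := Real.exp t₂
  have p1 : 0 < E₁ := by linarith
  have p2 : 0 < E₂ := by linarith
  rw [div_lt_div_iff₀ (by positivity) (by positivity)]
  have : 0 < (1 - 2 * δ) * (δ * (1 - δ)) * ((E₂ - E₁) * (E₁ * E₂ - 1)) := by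
    have q1 : 0 < E₂ - E₁ := sub_pos.2 hE
    have q2 : 0 < E₁ * E₂ - 1 := by nlinarith
    positivity
  linear_combination this

lemma oddsShift_pos {δ t : ℝ} (hδ : δ ∈ Ioo (0 : ℝ) (1 / 2)) (ht : 0 < t) : 0 < oddsShift δ t := by
  have := oddsShift_strictMono hδ ht
  rwa [oddsShift_zero] at this

lemma oddsShift_le_self {δ t : ℝ} (hδ : δ ∈ Ioo (0 : ℝ) (1 / 2)) (ht : 0 ≤ t) :
    oddsShift δ t ≤ t := by
  have h3 : 0 < 1 - δ := by linarith [hδ.2]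
  have h4 := hδ.1
  have hE : 1 ≤ Real.exp t := Real.one_le_exp ht
  have h : Real.log ((1 - δ) * Real.exp t + δ) ≤
      Real.log (Real.exp t * ((1 - δ) + δ * Real.exp t)) := by
    apply Real.log_le_log (by positivity)
    have : 1 ≤ Real.exp t * Real.exp t := by nlinarith
    nlinarith
  rw [Real.log_mul (by positivity) (by positivity), Real.log_exp] at h
  rw [oddsShift]
  linarith

lemma oddsShift_le_const {δ t : ℝ} (hδ : δ ∈ Ioo (0 : ℝ) (1 / 2)) :
    oddsShift δ t ≤ Real.log ((1 - δ) / δ) := by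
  have h3 : 0 < 1 - δ := by linarith [hδ.2]
  have h4 := hδ.1
  have hE := Real.exp_pos t
  rw [oddsShift, ← Real.log_div (by positivity) (by positivity)]
  apply Real.log_le_log (by positivity)
  rw [div_le_div_iff₀ (by positivity) (by positivity)]
  nlinarith [hδ.2]

/-- The derivative of `Φ` as a function of `σ`. -/
noncomputable def dualSlope (δ s : ℝ) : ℝ :=
  dualVar δ s / (Real.log (1 - s) - Real.log s)

lemma dualSlope_eq {δ s : ℝ} (hδ : δ ∈ Ioo (0 : ℝ) (1 / 2)) (hs : s ∈ Ioo (0 : ℝ) (1 / 2)) :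
    dualSlope δ s = dualVar δ s / (dualVar δ s + oddsShift δ (dualVar δ s)) := by
  rw [dualSlope, log_odds hδ ⟨hs.1, hs.2.le⟩]

lemma dualSlope_lt_one {δ s : ℝ} (hδ : δ ∈ Ioo (0 : ℝ) (1 / 2)) (hs : s ∈ Ioo (0 : ℝ) (1 / 2)) :
    dualSlope δ s < 1 := by
  have ht := dualVar_pos hδ hs
  have hg := oddsShift_pos hδ ht
  rw [dualSlope_eq hδ hs, div_lt_one (by positivity)]
  linarith

lemma half_le_dualSlope {δ s : ℝ} (hδ : δ ∈ Ioo (0 : ℝ) (1 / 2)) (hs : s ∈ Ioo (0 : ℝ) (1 / 2)) :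
    1 / 2 ≤ dualSlope δ s := by
  have ht := dualVar_pos hδ hs
  have hg := oddsShift_pos hδ ht
  have hg' := oddsShift_le_self hδ ht.le
  rw [dualSlope_eq hδ hs, div_le_div_iff₀ (by norm_num) (by positivity)]
  linarith

lemma log_odds_strictAnti {s₁ s₂ : ℝ} (h0 : 0 < s₁) (h : s₁ < s₂) (h1 : s₂ < 1) :
    Real.log (1 - s₂) - Real.log s₂ < Real.log (1 - s₁) - Real.log s₁ := by
  have := Real.log_lt_log h0 h
  have := Real.log_lt_log (show 0 < 1 - s₂ by linarith) (show 1 - s₂ < 1 - s₁ by linarith)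
  linarith

lemma dualSlope_strictAntiOn {δ : ℝ} (hδ : δ ∈ Ioo (0 : ℝ) (1 / 2)) :
    StrictAntiOn (dualSlope δ) (Ioo 0 (1 / 2)) := by
  intro s₁ hs₁ s₂ hs₂ h
  have hlt := log_odds_strictAnti hs₁.1 h (by linarith [hs₂.2])
  rw [log_odds hδ ⟨hs₁.1, hs₁.2.le⟩, log_odds hδ ⟨hs₂.1, hs₂.2.le⟩] at hlt
  rw [dualSlope_eq hδ hs₁, dualSlope_eq hδ hs₂]
  have p1 := dualVar_pos hδ hs₁
  have p2 := dualVar_pos hδ hs₂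
  set t₁ := dualVar δ s₁
  set t₂ := dualVar δ s₂
  have ht : t₂ < t₁ := by
    by_contra! hle
    have := (oddsShift_strictMono hδ).monotone hle
    linarith
  have hsec := (oddsShift_strictConcaveOn hδ).secant_strict_mono (a := 0) (x := t₂) (y := t₁)
    self_mem_Ici p2.le p1.le p2.ne' p1.ne' ht
  rw [oddsShift_zero, sub_zero, sub_zero, sub_zero, sub_zero, div_lt_div_iff₀ p1 p2] at hsec
  have g1 := oddsShift_pos hδ p1
  have g2 := oddsShift_pos hδ p2
  rw [div_lt_div_iff₀ (by positivity) (by positivity)]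
  linarith

lemma one_sub_dualSlope_le {δ s : ℝ} (hδ : δ ∈ Ioo (0 : ℝ) (1 / 2))
    (hs : s ∈ Ioo (0 : ℝ) (1 / 2)) :
    1 - Real.log ((1 - δ) / δ) / (Real.log (1 - s) - Real.log s) ≤ dualSlope δ s := by
  have ht := dualVar_pos hδ hs
  have hg := oddsShift_pos hδ ht
  have hg' := oddsShift_le_const (t := dualVar δ s) hδ
  rw [dualSlope_eq hδ hs, log_odds hδ ⟨hs.1, hs.2.le⟩, sub_le_iff_le_add, ← add_div,
    le_div_iff₀ (by positivity)]
  linarith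

lemma overlap_eq {δ : ℝ} (hδ : δ ∈ Ioo (0 : ℝ) (1 / 2)) : overlap δ = fun s =>
    (-δ ^ 2 + δ * √(δ ^ 2 + 4 * (1 - 2 * δ) * s * (1 - s))) / (2 * (1 - 2 * δ)) := by
  funext s
  rw [overlap, if_neg hδ.2.ne]

lemma continuous_overlap {δ : ℝ} (hδ : δ ∈ Ioo (0 : ℝ) (1 / 2)) : Continuous (overlap δ) := by
  rw [overlap_eq hδ]
  fun_prop

lemma differentiableAt_overlap {δ s : ℝ} (hδ : δ ∈ Ioo (0 : ℝ) (1 / 2))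
    (hs : s ∈ Icc (0 : ℝ) 1) : DifferentiableAt ℝ (overlap δ) s := by
  have h5 : 0 < 1 - 2 * δ := by linarith [hδ.2]
  have hs0 : 0 ≤ s * (1 - s) := mul_nonneg hs.1 (by linarith [hs.2])
  have h4 : 0 < δ ^ 2 := pow_pos hδ.1 2
  have hD : δ ^ 2 + 4 * (1 - 2 * δ) * s * (1 - s) ≠ 0 := by nlinarith
  rw [overlap_eq hδ]
  have : DifferentiableAt ℝ (fun s => √(δ ^ 2 + 4 * (1 - 2 * δ) * s * (1 - s))) s :=
    DifferentiableAt.sqrt (by fun_prop) hD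
  fun_prop

lemma hasDerivAt_pairExponent {δ s : ℝ} (hδ : δ ∈ Ioo (0 : ℝ) (1 / 2))
    (hs : s ∈ Ioo (0 : ℝ) (1 / 2)) :
    HasDerivAt (fun s => pairExponent δ s (overlap δ s)) (2 * dualVar δ s) s := by
  have hs' : s ∈ Ioc (0 : ℝ) (1 / 2) := ⟨hs.1, hs.2.le⟩
  have hy := overlap_pos hδ hs'
  have hp := sub_pos.2 (overlap_lt hδ hs')
  have hr : 0 < 1 - s - overlap δ s := by linarith [hs.2]
  have hd := (differentiableAt_overlap hδ ⟨hs.1.le, by linarith [hs.2]⟩).hasDerivAt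
  have d1 := ((hasDerivAt_negMulLog hy.ne').comp s hd).const_mul 2
  have d2 := (hasDerivAt_negMulLog hp.ne').comp s ((hasDerivAt_id' s).sub hd)
  have d3 := (hasDerivAt_negMulLog hr.ne').comp s (((hasDerivAt_id' s).const_sub 1).sub hd)
  have d4 := (hd.const_mul 2).mul_const (Real.log δ)
  have d5 := ((hd.const_mul 2).const_sub 1).mul_const (Real.log (1 - δ))
  have h := (((d1.add d2).add d3).add d4).add d5
  refine (h.congr_deriv ?_)
  obtain ⟨-, h2⟩ := optimal_type hδ hs'
  have l2 := congrArg Real.log h2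
  rw [Real.log_mul (by linarith [hδ.2]) hy.ne', Real.log_mul hδ.1.ne' (by positivity),
    Real.log_mul hp.ne' (by positivity), Real.log_exp] at l2
  have hdv : 2 * dualVar δ s = Real.log (1 - s - overlap δ s) - Real.log (s - overlap δ s) := by
    rw [dualVar]; ring
  linear_combination (-2 * deriv (overlap δ) s) * l2 + (-1 - deriv (overlap δ) s) * hdv

lemma continuous_pairExponent {δ : ℝ} (hδ : δ ∈ Ioo (0 : ℝ) (1 / 2)) :
    Continuous fun s => pairExponent δ s (overlap δ s) := by
  have := continuous_overlap hδ
  unfold pairExponent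
  fun_prop

lemma Phi_eqOn {δ : ℝ} (hδ : δ ∈ Icc (0 : ℝ) (1 / 2)) : EqOn (fun x => Phi x δ)
    (fun x => (pairExponent δ (Hinv x) (overlap δ (Hinv x)) - Real.log 2) / (2 * Real.log 2))
    (Icc 0 1) := by
  intro x hx
  have hl := log_two_pos
  simp only
  rw [eq_div_iff (by positivity), ← Phi_eq hδ hx]
  ring

lemma continuousOn_Phi {δ : ℝ} (hδ : δ ∈ Ioo (0 : ℝ) (1 / 2)) :
    ContinuousOn (fun x => Phi x δ) (Icc 0 1) := by
  refine ContinuousOn.congr ?_ (Phi_eqOn (Ioo_subset_Icc_self hδ))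
  exact (((continuous_pairExponent hδ).comp_continuousOn continuousOn_Hinv).sub
    continuousOn_const).div_const _

lemma hasDerivAt_Phi {δ x : ℝ} (hδ : δ ∈ Ioo (0 : ℝ) (1 / 2)) (hx : x ∈ Ioo (0 : ℝ) 1) :
    HasDerivAt (fun x => Phi x δ) (dualSlope δ (Hinv x)) x := by
  have h := (((hasDerivAt_pairExponent hδ (Hinv_mem_Ioo hx)).comp x
    (hasDerivAt_Hinv hx)).sub_const (Real.log 2)).div_const (2 * Real.log 2)
  have hl := log_two_pos.ne'
  refine (h.congr_deriv ?_).congr_of_eventuallyEq ?_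
  · rw [dualSlope]
    field_simp
  · filter_upwards [Icc_mem_nhds hx.1 hx.2] with z hz using
      Phi_eqOn (Ioo_subset_Icc_self hδ) hz

lemma tendsto_log_odds : Tendsto (fun s : ℝ => Real.log (1 - s) - Real.log s) (𝓝[>] 0) atTop := by
  have h1 : Tendsto (fun s : ℝ => Real.log (1 - s)) (𝓝[>] 0) (𝓝 0) := by
    have : ContinuousAt (fun s : ℝ => Real.log (1 - s)) 0 :=
      ContinuousAt.log (by fun_prop) (by norm_num)
    have h := this.tendsto
    simp only [sub_zero, Real.log_one] at h
    exact h.mono_left nhdsWithin_le_nhds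
  exact (h1.add_atTop (tendsto_neg_atBot_atTop.comp Real.tendsto_log_nhdsGT_zero)).congr
    fun s => (sub_eq_add_neg _ _).symm

lemma tendsto_Hinv_zero : Tendsto Hinv (𝓝[>] 0) (𝓝[>] 0) := by
  have h := (continuousOn_Hinv 0 ⟨le_rfl, zero_le_one⟩).tendsto
  rw [Hinv_zero] at h
  refine tendsto_nhdsWithin_iff.2 ⟨?_, ?_⟩
  · have h2 := h.mono_left (nhdsWithin_mono (0 : ℝ) Ioo_subset_Icc_self)
    rwa [nhdsWithin_Ioo_eq_nhdsGT zero_lt_one] at h2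
  · filter_upwards [Ioo_mem_nhdsGT zero_lt_one] with x hx using (Hinv_mem_Ioo hx).1

lemma tendsto_dualSlope_zero {δ : ℝ} (hδ : δ ∈ Ioo (0 : ℝ) (1 / 2)) :
    Tendsto (fun x => dualSlope δ (Hinv x)) (𝓝[>] 0) (𝓝 1) := by
  have h1 : Tendsto (fun x => 1 - Real.log ((1 - δ) / δ) /
      (Real.log (1 - Hinv x) - Real.log (Hinv x))) (𝓝[>] 0) (𝓝 (1 - 0)) :=
    tendsto_const_nhds.sub ((tendsto_log_odds.comp tendsto_Hinv_zero).const_div_atTop _)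
  rw [sub_zero] at h1
  refine tendsto_of_tendsto_of_tendsto_of_le_of_le' h1 tendsto_const_nhds ?_ ?_
  · filter_upwards [Ioo_mem_nhdsGT zero_lt_one] with x hx using
      one_sub_dualSlope_le hδ (Hinv_mem_Ioo hx)
  · filter_upwards [Ioo_mem_nhdsGT zero_lt_one] with x hx using
      (dualSlope_lt_one hδ (Hinv_mem_Ioo hx)).le

lemma dualSlope_Hinv_strictAntiOn {δ : ℝ} (hδ : δ ∈ Ioo (0 : ℝ) (1 / 2)) :
    StrictAntiOn (fun x => dualSlope δ (Hinv x)) (Ioo 0 1) := fun _ ha _ hb hab =>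
  dualSlope_strictAntiOn hδ (Hinv_mem_Ioo ha) (Hinv_mem_Ioo hb)
    (Hinv_strictMonoOn (Ioo_subset_Icc_self ha) (Ioo_subset_Icc_self hb) hab)

lemma hasDerivWithinAt_Phi_zero {δ : ℝ} (hδ : δ ∈ Ioo (0 : ℝ) (1 / 2)) :
    HasDerivWithinAt (fun x => Phi x δ) 1 (Icc 0 1) 0 := by
  refine (hasDerivWithinAt_Ici_of_tendsto_deriv (s := Ioo 0 1)
    (fun x hx => (hasDerivAt_Phi hδ hx).differentiableAt.differentiableWithinAt)
    ((continuousOn_Phi hδ 0 ⟨le_rfl, zero_le_one⟩).mono Ioo_subset_Icc_self)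
    (Ioo_mem_nhdsGT zero_lt_one) ?_).mono Icc_subset_Ici_self
  refine (tendsto_dualSlope_zero hδ).congr' ?_
  filter_upwards [Ioo_mem_nhdsGT zero_lt_one] with x hx using (hasDerivAt_Phi hδ hx).deriv.symm

lemma hasDerivWithinAt_Phi_one {δ : ℝ} (hδ : δ ∈ Ioo (0 : ℝ) (1 / 2)) :
    HasDerivWithinAt (fun x => Phi x δ)
      (sInf ((fun x => dualSlope δ (Hinv x)) '' Ioo 0 1)) (Icc 0 1) 1 := by
  refine (hasDerivWithinAt_Iic_of_tendsto_deriv (s := Ioo 0 1)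
    (fun x hx => (hasDerivAt_Phi hδ hx).differentiableAt.differentiableWithinAt)
    ((continuousOn_Phi hδ 1 ⟨zero_le_one, le_rfl⟩).mono Ioo_subset_Icc_self)
    (Ioo_mem_nhdsLT zero_lt_one) ?_).mono Icc_subset_Iic_self
  refine (AntitoneOn.tendsto_nhdsWithin_Ioo_left (nonempty_Ioo.2 zero_lt_one)
    (dualSlope_Hinv_strictAntiOn hδ).antitoneOn ⟨1 / 2, ?_⟩).congr' ?_
  · rintro _ ⟨x, hx, rfl⟩
    exact half_le_dualSlope hδ (Hinv_mem_Ioo hx)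
  · filter_upwards [Ioo_mem_nhdsLT zero_lt_one] with x hx using (hasDerivAt_Phi hδ hx).deriv.symm

lemma differentiableOn_Phi {δ : ℝ} (hδ : δ ∈ Ioo (0 : ℝ) (1 / 2)) :
    DifferentiableOn ℝ (fun x => Phi x δ) (Icc 0 1) := by
  intro x hx
  rcases hx.1.eq_or_lt with rfl | h0
  · exact (hasDerivWithinAt_Phi_zero hδ).differentiableWithinAt
  rcases hx.2.eq_or_lt with rfl | h1
  · exact (hasDerivWithinAt_Phi_one hδ).differentiableWithinAt
  exact (hasDerivAt_Phi hδ ⟨h0, h1⟩).differentiableAt.differentiableWithinAt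

lemma derivWithin_Phi {δ x : ℝ} (hδ : δ ∈ Ioo (0 : ℝ) (1 / 2)) (hx : x ∈ Ioo (0 : ℝ) 1) :
    derivWithin (fun x => Phi x δ) (Icc 0 1) x = dualSlope δ (Hinv x) := by
  rw [derivWithin_of_mem_nhds (Icc_mem_nhds hx.1 hx.2), (hasDerivAt_Phi hδ hx).deriv]

lemma derivWithin_Phi_zero {δ : ℝ} (hδ : δ ∈ Ioo (0 : ℝ) (1 / 2)) :
    derivWithin (fun x => Phi x δ) (Icc 0 1) 0 = 1 :=
  (hasDerivWithinAt_Phi_zero hδ).derivWithin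
    (uniqueDiffOn_Icc zero_lt_one _ ⟨le_rfl, zero_le_one⟩)

lemma derivWithin_Phi_one {δ : ℝ} (hδ : δ ∈ Ioo (0 : ℝ) (1 / 2)) :
    derivWithin (fun x => Phi x δ) (Icc 0 1) 1 =
      sInf ((fun x => dualSlope δ (Hinv x)) '' Ioo 0 1) :=
  (hasDerivWithinAt_Phi_one hδ).derivWithin
    (uniqueDiffOn_Icc zero_lt_one _ ⟨zero_le_one, le_rfl⟩)

lemma half_le_derivWithin_Phi {δ x : ℝ} (hδ : δ ∈ Ioo (0 : ℝ) (1 / 2)) (hx : x ∈ Icc (0 : ℝ) 1) :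
    1 / 2 ≤ derivWithin (fun x => Phi x δ) (Icc 0 1) x := by
  rcases hx.1.eq_or_lt with rfl | h0
  · rw [derivWithin_Phi_zero hδ]; norm_num
  rcases hx.2.eq_or_lt with rfl | h1
  · rw [derivWithin_Phi_one hδ]
    refine le_csInf ((nonempty_Ioo.2 zero_lt_one).image _) ?_
    rintro _ ⟨x, hx, rfl⟩
    exact half_le_dualSlope hδ (Hinv_mem_Ioo hx)
  rw [derivWithin_Phi hδ ⟨h0, h1⟩]
  exact half_le_dualSlope hδ (Hinv_mem_Ioo ⟨h0, h1⟩)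

lemma derivWithin_Phi_one_lt {δ x : ℝ} (hδ : δ ∈ Ioo (0 : ℝ) (1 / 2)) (hx : x ∈ Ioo (0 : ℝ) 1) :
    derivWithin (fun x => Phi x δ) (Icc 0 1) 1 < dualSlope δ (Hinv x) := by
  obtain ⟨z, hxz, hz⟩ := exists_between hx.2
  have hz' : z ∈ Ioo (0 : ℝ) 1 := ⟨hx.1.trans hxz, hz⟩
  refine lt_of_le_of_lt ?_ (dualSlope_Hinv_strictAntiOn hδ hx hz' hxz)
  rw [derivWithin_Phi_one hδ]
  refine csInf_le ⟨1 / 2, ?_⟩ ⟨z, hz', rfl⟩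
  rintro _ ⟨x, hx, rfl⟩
  exact half_le_dualSlope hδ (Hinv_mem_Ioo hx)

lemma derivWithin_Phi_strictAntiOn {δ : ℝ} (hδ : δ ∈ Ioo (0 : ℝ) (1 / 2)) :
    StrictAntiOn (derivWithin (fun x => Phi x δ) (Icc 0 1)) (Icc 0 1) := by
  intro a ha b hb hab
  rcases ha.1.eq_or_lt with rfl | ha0
  · rw [derivWithin_Phi_zero hδ]
    rcases hb.2.eq_or_lt with rfl | hb1
    · have hm : (1 / 2 : ℝ) ∈ Ioo (0 : ℝ) 1 := by norm_num
      exact (derivWithin_Phi_one_lt hδ hm).trans (dualSlope_lt_one hδ (Hinv_mem_Ioo hm))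
    · rw [derivWithin_Phi hδ ⟨hab, hb1⟩]
      exact dualSlope_lt_one hδ (Hinv_mem_Ioo ⟨hab, hb1⟩)
  · have ha' : a ∈ Ioo (0 : ℝ) 1 := ⟨ha0, hab.trans_le hb.2⟩
    rw [derivWithin_Phi hδ ha']
    rcases hb.2.eq_or_lt with rfl | hb1
    · exact derivWithin_Phi_one_lt hδ ha'
    · rw [derivWithin_Phi hδ ⟨ha0.trans hab, hb1⟩]
      exact dualSlope_Hinv_strictAntiOn hδ ha' ⟨ha0.trans hab, hb1⟩ hab

/-- The two-point inequality is attained. -/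
lemma two_point_eq {δ x : ℝ} (hδ : δ ∈ Ioo (0 : ℝ) (1 / 2)) (hx : x ∈ Ioo (0 : ℝ) 1) :
    ∃ a : ℝ, 0 < a ∧ Real.log ((1 - δ) * (a ^ 2 + 1) + 2 * δ * a) =
      2 * Real.log 2 * Phi x δ + Real.log 2 +
        2 * dualSlope δ (Hinv x) * Real.log (a ^ (1 / dualSlope δ (Hinv x)) + 1) -
        2 * dualSlope δ (Hinv x) * (x * Real.log 2) := by
  have hs := Hinv_mem_Ioo hx
  have hs' : Hinv x ∈ Ioc (0 : ℝ) (1 / 2) := ⟨hs.1, hs.2.le⟩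
  have hxx : x = H (Hinv x) := (H_Hinv (Ioo_subset_Icc_self hx)).symm
  have hPhi := Phi_eq (Ioo_subset_Icc_self hδ) (Ioo_subset_Icc_self hx)
  have hH := H_mul_log_two (Hinv x)
  rw [← hxx] at hH
  obtain ⟨h1, h2⟩ := optimal_type hδ hs'
  have ht := dualVar_pos hδ hs
  set s := Hinv x with hsdef
  refine ⟨Real.exp (dualVar δ s), Real.exp_pos _, ?_⟩
  have hlo : 0 < Real.log (1 - s) - Real.log s :=
    sub_pos.2 (Real.log_lt_log hs.1 (by linarith [hs.2]))
  have hpow : Real.exp (dualVar δ s) ^ (1 / dualSlope δ s) + 1 = 1 / s := by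
    rw [← Real.exp_mul, dualSlope, one_div_div, mul_div_cancel₀ _ ht.ne', Real.exp_sub,
      Real.exp_log hs.1, Real.exp_log (by linarith [hs.2])]
    have := hs.1.ne'
    field_simp
    ring
  have hslope : dualSlope δ s * (Real.log (1 - s) - Real.log s) = dualVar δ s := by
    rw [dualSlope, div_mul_cancel₀ _ hlo.ne']
  have hp := sub_pos.2 (overlap_lt hδ hs')
  have hδ1 : 0 < 1 - δ := by linarith [hδ.2]
  have hδ0 := hδ.1
  obtain ⟨Z, hZ⟩ : ∃ Z, Z = (1 - δ) * (Real.exp (dualVar δ s) ^ 2 + 1 ^ 2) +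
    2 * δ * (Real.exp (dualVar δ s) * 1) := ⟨_, rfl⟩
  have hR := Real.exp_pos (dualVar δ s)
  have hZ0 : 0 < Z := by rw [hZ]; positivity
  have hpZ : (s - overlap δ s) * Z = 1 - δ := by
    rw [hZ]
    linear_combination (-(1 - δ)) * h1 - 2 * h2
  have es : s = ((1 - δ) * 1 ^ 2 + δ * (Real.exp (dualVar δ s) * 1)) / Z := by
    rw [eq_div_iff hZ0.ne']
    have k : overlap δ s * Z = δ * Real.exp (dualVar δ s) := by
      apply mul_left_cancel₀ hδ1.ne'
      rw [← mul_assoc, h2]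
      linear_combination (δ * Real.exp (dualVar δ s)) * hpZ
    linear_combination hpZ + k
  have ey : overlap δ s = δ * (Real.exp (dualVar δ s) * 1) / Z := by
    rw [eq_div_iff hZ0.ne']
    apply mul_left_cancel₀ hδ1.ne'
    rw [← mul_assoc, h2]
    linear_combination (δ * Real.exp (dualVar δ s)) * hpZ
  have hG := pairExponent_gibbs (Ioo_subset_Icc_self hδ) hR zero_le_one hZ es ey
  rw [Real.log_exp, Real.log_one] at hG
  have hZ' : (1 - δ) * (Real.exp (dualVar δ s) ^ 2 + 1) + 2 * δ * Real.exp (dualVar δ s) = Z := by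
    rw [hZ]; ring
  rw [hZ', hpow, hPhi, hG, hH, one_div, Real.log_inv, negMulLog, negMulLog]
  linear_combination (-2 * (1 - s)) * hslope

/-! ### Properties of `φ_ε` -/

lemma noiseParam_mem_Icc {ε : ℝ} (hε : ε ∈ Icc (0 : ℝ) (1 / 2)) :
    2 * ε * (1 - ε) ∈ Icc (0 : ℝ) (1 / 2) :=
  ⟨by nlinarith [hε.1, hε.2], by nlinarith [sq_nonneg (1 - 2 * ε)]⟩

lemma noiseParam_mem_Ioo {ε : ℝ} (hε : ε ∈ Ioo (0 : ℝ) (1 / 2)) :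
    2 * ε * (1 - ε) ∈ Ioo (0 : ℝ) (1 / 2) :=
  ⟨by nlinarith [hε.1, hε.2], by nlinarith [pow_pos (show 0 < 1 - 2 * ε by linarith [hε.2]) 2]⟩

lemma phi_zero_eqOn : EqOn (phi 0) (fun x => (x - 1) / 2) (Icc 0 1) := by
  intro x hx
  have hd : (2 * 0 * (1 - 0) : ℝ) = 0 := by norm_num
  have h := Phi_eq (δ := 0) ⟨le_rfl, by norm_num⟩ hx
  have ho : overlap 0 (Hinv x) = 0 := overlap_eq_of_quadratic ⟨le_rfl, by norm_num⟩ le_rfl (by ring)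
  have hH := H_mul_log_two (Hinv x)
  rw [H_Hinv hx] at hH
  rw [ho, pairExponent] at h
  simp only [negMulLog_zero, sub_zero, mul_zero, zero_mul, Real.log_one, add_zero, zero_add] at h
  rw [← hH] at h
  have hl := log_two_pos.ne'
  simp only [phi, hd]
  apply mul_left_cancel₀ (mul_ne_zero two_ne_zero hl)
  rw [h]; ring

lemma phi_half_eqOn : EqOn (phi (1 / 2)) (fun x => x - 1) (Icc 0 1) := by
  intro x hx
  have hd : (2 * (1 / 2) * (1 - 1 / 2) : ℝ) = 1 / 2 := by norm_num
  have hs := Hinv_mem hx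
  have h := Phi_eq (δ := 1 / 2) ⟨by norm_num, le_rfl⟩ hx
  have ho : overlap (1 / 2) (Hinv x) = Hinv x * (1 - Hinv x) := by simp [overlap]
  have hH := H_mul_log_two (Hinv x)
  rw [H_Hinv hx] at hH
  have h1 : Hinv x - Hinv x * (1 - Hinv x) = Hinv x * Hinv x := by ring
  have h2 : 1 - Hinv x - Hinv x * (1 - Hinv x) = (1 - Hinv x) * (1 - Hinv x) := by ring
  have h3 : (1 - 1 / 2 : ℝ) = 1 / 2 := by norm_num
  rw [ho, pairExponent, h1, h2, negMulLog_mul, negMulLog_mul, negMulLog_mul, h3, one_div,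
    Real.log_inv] at h
  have hl := log_two_pos.ne'
  simp only [phi, hd]
  apply mul_left_cancel₀ (mul_ne_zero two_ne_zero hl)
  rw [one_div, h]
  linear_combination (-2) * hH

lemma hasDerivWithinAt_phi_zero {x : ℝ} (hx : x ∈ Icc (0 : ℝ) 1) :
    HasDerivWithinAt (phi 0) (1 / 2) (Icc 0 1) x :=
  ((((hasDerivAt_id' x).sub_const 1).div_const 2).hasDerivWithinAt).congr
    (fun _ hz => phi_zero_eqOn hz) (phi_zero_eqOn hx)

lemma hasDerivWithinAt_phi_half {x : ℝ} (hx : x ∈ Icc (0 : ℝ) 1) :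
    HasDerivWithinAt (phi (1 / 2)) 1 (Icc 0 1) x :=
  (((hasDerivAt_id' x).sub_const 1).hasDerivWithinAt).congr
    (fun _ hz => phi_half_eqOn hz) (phi_half_eqOn hx)

lemma phi'_of_eps_zero {x : ℝ} (hx : x ∈ Icc (0 : ℝ) 1) : phi' 0 x = 1 / 2 :=
  (hasDerivWithinAt_phi_zero hx).derivWithin (uniqueDiffOn_Icc zero_lt_one _ hx)

lemma phi'_of_eps_half {x : ℝ} (hx : x ∈ Icc (0 : ℝ) 1) : phi' (1 / 2) x = 1 :=
  (hasDerivWithinAt_phi_half hx).derivWithin (uniqueDiffOn_Icc zero_lt_one _ hx)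

lemma eps_cases {ε : ℝ} (hε : ε ∈ Icc (0 : ℝ) (1 / 2)) :
    ε = 0 ∨ ε = 1 / 2 ∨ ε ∈ Ioo (0 : ℝ) (1 / 2) := by
  rcases hε.1.eq_or_lt with h | h
  · exact Or.inl h.symm
  rcases hε.2.eq_or_lt with h' | h'
  · exact Or.inr (Or.inl h')
  · exact Or.inr (Or.inr ⟨h, h'⟩)

lemma differentiableOn_phi {ε : ℝ} (hε : ε ∈ Icc (0 : ℝ) (1 / 2)) :
    DifferentiableOn ℝ (phi ε) (Icc 0 1) := by
  rcases eps_cases hε with rfl | rfl | h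
  · exact fun x hx => (hasDerivWithinAt_phi_zero hx).differentiableWithinAt
  · exact fun x hx => (hasDerivWithinAt_phi_half hx).differentiableWithinAt
  · exact differentiableOn_Phi (noiseParam_mem_Ioo h)

lemma phi'_strictAntiOn {ε : ℝ} (hε : ε ∈ Ioo (0 : ℝ) (1 / 2)) :
    StrictAntiOn (phi' ε) (Icc 0 1) :=
  derivWithin_Phi_strictAntiOn (noiseParam_mem_Ioo hε)

lemma phi'_antitoneOn {ε : ℝ} (hε : ε ∈ Icc (0 : ℝ) (1 / 2)) :
    AntitoneOn (phi' ε) (Icc 0 1) := by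
  rcases eps_cases hε with rfl | rfl | h
  · intro a ha b hb _
    rw [phi'_of_eps_zero ha, phi'_of_eps_zero hb]
  · intro a ha b hb _
    rw [phi'_of_eps_half ha, phi'_of_eps_half hb]
  · exact (phi'_strictAntiOn h).antitoneOn

lemma phi'_at_zero {ε : ℝ} (hε : ε ∈ Ioc (0 : ℝ) (1 / 2)) : phi' ε 0 = 1 := by
  rcases hε.2.eq_or_lt with rfl | h
  · exact phi'_of_eps_half ⟨le_rfl, zero_le_one⟩
  · exact derivWithin_Phi_zero (noiseParam_mem_Ioo ⟨hε.1, h⟩)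

lemma half_le_phi' {ε x : ℝ} (hε : ε ∈ Icc (0 : ℝ) (1 / 2)) (hx : x ∈ Icc (0 : ℝ) 1) :
    1 / 2 ≤ phi' ε x := by
  rcases eps_cases hε with rfl | rfl | h
  · rw [phi'_of_eps_zero hx]
  · rw [phi'_of_eps_half hx]; norm_num
  · exact half_le_derivWithin_Phi (noiseParam_mem_Ioo h) hx

lemma phi'_le_one {ε x : ℝ} (hε : ε ∈ Icc (0 : ℝ) (1 / 2)) (hx : x ∈ Icc (0 : ℝ) 1) :
    phi' ε x ≤ 1 := by
  rcases hε.1.eq_or_lt with rfl | h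
  · rw [phi'_of_eps_zero hx]; norm_num
  · rw [← phi'_at_zero ⟨h, hε.2⟩]
    exact phi'_antitoneOn hε ⟨le_rfl, zero_le_one⟩ hx hx.1

lemma phi'_lt_one {ε x : ℝ} (hε : ε ∈ Ico (0 : ℝ) (1 / 2)) (hx : x ∈ Ioc (0 : ℝ) 1) :
    phi' ε x < 1 := by
  rcases hε.1.eq_or_lt with rfl | h
  · rw [phi'_of_eps_zero ⟨hx.1.le, hx.2⟩]; norm_num
  · rw [← phi'_at_zero ⟨h, hε.2.le⟩]
    exact phi'_strictAntiOn ⟨h, hε.2⟩ ⟨le_rfl, zero_le_one⟩ ⟨hx.1.le, hx.2⟩ hx.1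

lemma hasDerivWithinAt_phi {ε x : ℝ} (hε : ε ∈ Icc (0 : ℝ) (1 / 2)) (hx : x ∈ Icc (0 : ℝ) 1) :
    HasDerivWithinAt (phi ε) (phi' ε x) (Icc 0 1) x :=
  (differentiableOn_phi hε x hx).hasDerivWithinAt

lemma phi_mean_value {ε a b : ℝ} (hε : ε ∈ Icc (0 : ℝ) (1 / 2)) (ha : 0 ≤ a) (hb : b ≤ 1)
    (hab : a < b) : ∃ c ∈ Ioo a b, phi ε b - phi ε a = phi' ε c * (b - a) := by
  obtain ⟨c, hc, h⟩ := exists_hasDerivAt_eq_slope (phi ε) (phi' ε) hab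
    ((differentiableOn_phi hε).continuousOn.mono (Icc_subset_Icc ha hb))
    (fun c hc => (hasDerivWithinAt_phi hε ⟨ha.trans hc.1.le, hc.2.le.trans hb⟩).hasDerivAt
      (Icc_mem_nhds (ha.trans_lt hc.1) (hc.2.trans_le hb)))
  refine ⟨c, hc, ?_⟩
  rw [h, div_mul_cancel₀ _ (sub_pos.2 hab).ne']

lemma phi_le_tangent {ε x z : ℝ} (hε : ε ∈ Icc (0 : ℝ) (1 / 2)) (hx : x ∈ Icc (0 : ℝ) 1)
    (hz : z ∈ Icc (0 : ℝ) 1) : phi ε z - phi' ε x * z ≤ phi ε x - phi' ε x * x := by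
  rcases lt_trichotomy x z with h | rfl | h
  · obtain ⟨c, hc, e⟩ := phi_mean_value hε hx.1 hz.2 h
    have := phi'_antitoneOn hε hx ⟨hx.1.trans hc.1.le, hc.2.le.trans hz.2⟩ hc.1.le
    nlinarith
  · exact le_rfl
  · obtain ⟨c, hc, e⟩ := phi_mean_value hε hz.1 hx.2 h
    have := phi'_antitoneOn hε ⟨hz.1.trans hc.1.le, hc.2.le.trans hx.2⟩ hx hc.2.le
    nlinarith

lemma phi_lt_tangent {ε x z : ℝ} (hε : ε ∈ Ioo (0 : ℝ) (1 / 2)) (hx : x ∈ Icc (0 : ℝ) 1)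
    (hz : z ∈ Icc (0 : ℝ) 1) (hne : z ≠ x) :
    phi ε z - phi' ε x * z < phi ε x - phi' ε x * x := by
  rcases lt_or_gt_of_ne hne with h | h
  · obtain ⟨c, hc, e⟩ := phi_mean_value (Ioo_subset_Icc_self hε) hz.1 hx.2 h
    have := phi'_strictAntiOn hε ⟨hz.1.trans hc.1.le, hc.2.le.trans hx.2⟩ hx hc.2
    nlinarith
  · obtain ⟨c, hc, e⟩ := phi_mean_value (Ioo_subset_Icc_self hε) hx.1 hz.2 h
    have := phi'_strictAntiOn hε hx ⟨hx.1.trans hc.1.le, hc.2.le.trans hz.2⟩ hc.1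
    nlinarith

lemma existsUnique_phi'_eq {q ε x : ℝ} (hq : 1 < q) (hε : ε ∈ Ioc (0 : ℝ) (1 / 2))
    (hx : x ∈ Icc (0 : ℝ) 1) (h : phi' ε (1 - x) < 1 / q) :
    ∃! α : ℝ, α ∈ Icc (0 : ℝ) 1 ∧ phi' ε α = 1 / q := by
  have hx' : 1 - x ∈ Icc (0 : ℝ) 1 := ⟨by linarith [hx.2], by linarith [hx.1]⟩
  have hq1 : 1 / q < 1 := by rw [div_lt_one (by linarith)]; exact hq
  have hε' : ε ∈ Icc (0 : ℝ) (1 / 2) := ⟨hε.1.le, hε.2⟩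
  rcases hε.2.eq_or_lt with rfl | hlt
  · rw [phi'_of_eps_half hx'] at h
    linarith
  · have hsub : Icc 0 (1 - x) ⊆ Icc 0 1 := Icc_subset_Icc_right hx'.2
    obtain ⟨α, hα, e⟩ := exists_hasDerivWithinAt_eq_of_lt_of_gt hx'.1
      (fun z hz => (hasDerivWithinAt_phi hε' (hsub hz)).mono hsub)
      (show 1 / q < phi' ε 0 by rwa [phi'_at_zero hε]) h
    have hα' := hsub (Ioo_subset_Icc_self hα)
    exact ⟨α, ⟨hα', e⟩, fun β hβ =>
      (phi'_strictAntiOn ⟨hε.1, hlt⟩).injOn hβ.1 hα' (hβ.2.trans e.symm)⟩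

/-! ### `ψ_{2,q}` as a minimum of affine functions -/

lemma psi_repr {q ε x : ℝ} (hq : 1 < q) (hε : ε ∈ Icc (0 : ℝ) (1 / 2))
    (hx : x ∈ Icc (0 : ℝ) 1) :
    ∃ s β : ℝ, 1 / 2 ≤ s ∧ 1 / q ≤ s ∧ s ≤ 1 ∧ β ∈ Icc (0 : ℝ) 1 ∧ β ≤ 1 - x ∧
      (s = 1 / q ∨ β = 1 - x) ∧
      (∀ z ∈ Icc (0 : ℝ) 1, phi ε z - s * z ≤ phi ε β - s * β) ∧
      (ε < 1 / 2 → x < 1 → s < 1) ∧ (0 < ε → phi' ε β = s) ∧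
      psi q x ε = 2 * (phi ε β + (1 - β) * s + (1 - s) * x) := by
  have hx' : 1 - x ∈ Icc (0 : ℝ) 1 := ⟨by linarith [hx.2], by linarith [hx.1]⟩
  have hq0 : 0 < q := by linarith
  have hq1 : 1 / q < 1 := by rw [div_lt_one hq0]; exact hq
  by_cases h : phi' ε (1 - x) < 1 / q
  · have hhalf := (half_le_phi' hε hx').trans h.le
    have hpsi : psi q x ε =
        2 * (phi ε (alpha0 q ε) + (1 - alpha0 q ε) * (1 / q) + (1 - 1 / q) * x) := by
      rw [psi, if_pos h]
      field_simp
      ring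
    rcases hε.1.eq_or_lt with rfl | hε0
    · have hα : alpha0 q 0 = 0 := if_pos rfl
      rw [hα] at hpsi
      have h0 : (0 : ℝ) ∈ Icc (0 : ℝ) 1 := ⟨le_rfl, zero_le_one⟩
      refine ⟨1 / q, 0, hhalf, le_rfl, hq1.le, h0, hx'.1, Or.inl rfl,
        fun z hz => ?_, fun _ _ => hq1, fun h => absurd h (lt_irrefl _), hpsi⟩
      rw [phi_zero_eqOn hz, phi_zero_eqOn h0]
      simp only
      nlinarith [hz.1]
    · have hex := (existsUnique_phi'_eq hq ⟨hε0, hε.2⟩ hx h).exists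
      have hα : alpha0 q ε = Function.invFunOn (phi' ε) (Icc 0 1) (1 / q) := if_neg hε0.ne'
      have hmem : alpha0 q ε ∈ Icc (0 : ℝ) 1 := hα ▸ Function.invFunOn_mem hex
      have heq : phi' ε (alpha0 q ε) = 1 / q := hα ▸ Function.invFunOn_eq hex
      refine ⟨1 / q, alpha0 q ε, hhalf, le_rfl, hq1.le, hmem, ?_, Or.inl rfl,
        fun z hz => ?_, fun _ _ => hq1, fun _ => heq, hpsi⟩
      · by_contra! hlt
        have := phi'_antitoneOn hε hx' hmem hlt.le
        linarith
      · rw [← heq]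
        exact phi_le_tangent hε hmem hz
  · refine ⟨phi' ε (1 - x), 1 - x, half_le_phi' hε hx', not_lt.1 h, phi'_le_one hε hx', hx',
      le_rfl, Or.inr rfl, fun z hz => phi_le_tangent hε hx' hz,
      fun h1 h2 => phi'_lt_one ⟨hε.1, h1⟩ ⟨by linarith, hx'.2⟩, fun _ => rfl, ?_⟩
    rw [psi, if_neg h]
    ring

lemma psi_le_affine {q ε x s β : ℝ} (hq : 1 < q) (hε : ε ∈ Icc (0 : ℝ) (1 / 2))
    (hx : x ∈ Icc (0 : ℝ) 1) (hs : 1 / q ≤ s)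
    (hmax : ∀ z ∈ Icc (0 : ℝ) 1, phi ε z - s * z ≤ phi ε β - s * β) :
    psi q x ε ≤ 2 * (phi ε β + (1 - β) * s + (1 - s) * x) := by
  obtain ⟨t, γ, -, -, -, hγ, hγx, hor, -, -, -, e⟩ := psi_repr hq hε hx
  rw [e]
  have h := hmax γ hγ
  have h2 : 0 ≤ (s - t) * (1 - γ - x) := by
    rcases hor with rfl | rfl
    · exact mul_nonneg (by linarith) (by linarith)
    · exact (by ring : (s - t) * (1 - (1 - x) - x) = 0).ge
  linarith

lemma psi_monotoneOn {q ε : ℝ} (hq : 1 < q) (hε : ε ∈ Icc (0 : ℝ) (1 / 2)) :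
    MonotoneOn (fun x => psi q x ε) (Icc 0 1) := by
  intro a ha b hb hab
  obtain ⟨s, β, -, hs, hs1, -, -, -, hmax, -, -, e⟩ := psi_repr hq hε hb
  have h := psi_le_affine hq hε ha hs hmax
  simp only
  rw [e]
  nlinarith

lemma psi_strictMonoOn {q ε : ℝ} (hq : 1 < q) (hε : ε ∈ Ico (0 : ℝ) (1 / 2)) :
    StrictMonoOn (fun x => psi q x ε) (Icc 0 1) := by
  have hε' : ε ∈ Icc (0 : ℝ) (1 / 2) := ⟨hε.1, hε.2.le⟩
  intro a ha b hb hab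
  obtain ⟨c, hac, hcb⟩ := exists_between hab
  have hc : c ∈ Icc (0 : ℝ) 1 := ⟨ha.1.trans hac.le, hcb.le.trans hb.2⟩
  obtain ⟨s, β, -, hs, -, -, -, -, hmax, hs1, -, e⟩ := psi_repr hq hε' hc
  have h := psi_le_affine hq hε' ha hs hmax
  have h1 := hs1 hε.2 (hcb.trans_le hb.2)
  refine lt_of_lt_of_le (b := psi q c ε) ?_ (psi_monotoneOn hq hε' hc hb hcb.le)
  simp only
  rw [e]
  nlinarith

lemma psi_concaveOn {q ε : ℝ} (hq : 1 < q) (hε : ε ∈ Icc (0 : ℝ) (1 / 2)) :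
    ConcaveOn ℝ (Icc 0 1) (fun x => psi q x ε) := by
  refine ⟨convex_Icc 0 1, fun x hx y hy a b ha hb hab => ?_⟩
  have hz := convex_Icc (0 : ℝ) 1 hx hy ha hb hab
  obtain ⟨s, β, -, hs, -, -, -, -, hmax, -, -, e⟩ := psi_repr hq hε hz
  have h1 := mul_le_mul_of_nonneg_left (psi_le_affine hq hε hx hs hmax) ha
  have h2 := mul_le_mul_of_nonneg_left (psi_le_affine hq hε hy hs hmax) hb
  simp only [smul_eq_mul] at e ⊢
  rw [e]
  have hb' : b = 1 - a := by linarith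
  subst hb'
  linarith

/-! ### The noise operator on the cube -/

lemma hammingDist_cons {n : ℕ} (u v : Bool) (y x : Cube n) :
    hammingDist (Fin.cons u y : Cube (n + 1)) (Fin.cons v x : Cube (n + 1)) =
      (if u = v then 0 else 1) + hammingDist y x := by
  simp only [hammingDist, Finset.card_filter]
  rw [Fin.sum_univ_succ]
  simp only [Fin.cons_zero, Fin.cons_succ]
  congr 1
  by_cases h : u = v <;> simp [h]

lemma hammingDist_le {n : ℕ} (y x : Cube n) : hammingDist y x ≤ n := by
  simpa using hammingDist_le_card_fintype (x := y) (y := x)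

lemma sum_cube_succ {n : ℕ} (F : Cube (n + 1) → ℝ) :
    ∑ z, F z = ∑ z : Cube n, F (Fin.cons true z) + ∑ z : Cube n, F (Fin.cons false z) := by
  rw [← (Fin.consEquiv fun _ : Fin (n + 1) => Bool).sum_comp F, Fintype.sum_prod_type,
    Fintype.sum_bool]
  rfl

lemma noise_cons {n : ℕ} (ε : ℝ) (f : Cube (n + 1) → ℝ) (u : Bool) (z : Cube n) :
    noise ε f (Fin.cons u z) = (1 - ε) * noise ε (fun w => f (Fin.cons u w)) z +
      ε * noise ε (fun w => f (Fin.cons (!u) w)) z := by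
  have e1 : ∀ y : Cube n, n + 1 - hammingDist y z = n - hammingDist y z + 1 := fun y => by
    have := hammingDist_le y z
    omega
  have e2 : ∀ y : Cube n, n + 1 - (1 + hammingDist y z) = n - hammingDist y z := fun y => by omega
  simp only [noise, Finset.mul_sum]
  rw [sum_cube_succ, ← Finset.sum_add_distrib, ← Finset.sum_add_distrib]
  refine Finset.sum_congr rfl fun y _ => ?_
  cases u <;>
    simp only [hammingDist_cons, e1, e2, if_true, if_false, Bool.not_true, Bool.not_false,
      zero_add, reduceCtorEq, pow_add, pow_one] <;> ring

lemma noise_nonneg {n : ℕ} {ε : ℝ} (h0 : 0 ≤ ε) (h1 : ε ≤ 1) {f : Cube n → ℝ}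
    (hf : ∀ z, 0 ≤ f z) (z : Cube n) : 0 ≤ noise ε f z :=
  Finset.sum_nonneg fun y _ => mul_nonneg
    (mul_nonneg (pow_nonneg h0 _) (pow_nonneg (by linarith) _)) (hf y)

lemma noise_mono {n : ℕ} {ε : ℝ} (h0 : 0 ≤ ε) (h1 : ε ≤ 1) {f g : Cube n → ℝ}
    (hfg : ∀ z, f z ≤ g z) (z : Cube n) : noise ε f z ≤ noise ε g z :=
  Finset.sum_le_sum fun y _ => mul_le_mul_of_nonneg_left (hfg y)
    (mul_nonneg (pow_nonneg h0 _) (pow_nonneg (by linarith) _))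

lemma pow_mul_le_noise {n : ℕ} {ε : ℝ} (h0 : 0 ≤ ε) (h1 : ε ≤ 1) {f : Cube n → ℝ}
    (hf : ∀ z, 0 ≤ f z) (z : Cube n) : (1 - ε) ^ n * f z ≤ noise ε f z := by
  have h := Finset.single_le_sum (f := fun y => ε ^ hammingDist y z *
    (1 - ε) ^ (n - hammingDist y z) * f y) (fun y _ => mul_nonneg
    (mul_nonneg (pow_nonneg h0 _) (pow_nonneg (by linarith) _)) (hf y)) (Finset.mem_univ z)
  simp only [hammingDist_self, pow_zero, one_mul, Nat.sub_zero] at h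
  exact h

/-- Tensorization of two-function hypercontractive inequalities with a constant. -/
theorem sum_noise_sq_le {ε p K : ℝ} (h0 : 0 ≤ ε) (h1 : ε ≤ 1) (hp : 0 < p) (hp2 : p ≤ 2)
    (hK : 0 ≤ K) (h : ∀ a b : ℝ, 0 ≤ a → 0 ≤ b →
      ((1 - ε) * a + ε * b) ^ 2 + ((1 - ε) * b + ε * a) ^ 2 ≤ K * (a ^ p + b ^ p) ^ (2 / p)) :
    ∀ (n : ℕ) (f : Cube n → ℝ), (∀ z, 0 ≤ f z) →
      ∑ z, noise ε f z ^ 2 ≤ K ^ n * (∑ z, f z ^ p) ^ (2 / p) := by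
  have hrp : ∀ u : ℝ, 0 ≤ u → (u ^ p) ^ (2 / p) = u ^ 2 := fun u hu => by
    rw [← Real.rpow_mul hu, mul_div_cancel₀ _ hp.ne']
    exact_mod_cast Real.rpow_natCast u 2
  intro n
  induction n with
  | zero =>
    intro f hf
    have : ∀ z, noise ε f z = f z := fun z => by
      rw [noise, Finset.sum_eq_single z (fun b _ hb => absurd (Subsingleton.elim b z) hb)
        (fun h => absurd (Finset.mem_univ z) h)]
      simp
    simp only [this, Fintype.sum_unique, pow_zero, one_mul]
    rw [hrp _ (hf _)]
  | succ n ih =>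
    intro f hf
    have hN : 1 ≤ 2 / p := by rwa [le_div_iff₀ hp, one_mul]
    have hN0 : 2 / p ≠ 0 := by positivity
    set g₁ := noise ε fun w : Cube n => f (Fin.cons true w) with hg₁
    set g₀ := noise ε fun w : Cube n => f (Fin.cons false w) with hg₀
    have g₁0 : ∀ z, 0 ≤ g₁ z := noise_nonneg h0 h1 fun w => hf _
    have g₀0 : ∀ z, 0 ≤ g₀ z := noise_nonneg h0 h1 fun w => hf _
    have i₁ := ih (fun w => f (Fin.cons true w)) fun w => hf _
    have i₀ := ih (fun w => f (Fin.cons false w)) fun w => hf _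
    rw [← hg₁] at i₁
    rw [← hg₀] at i₀
    set F₁ := ∑ w : Cube n, f (Fin.cons true w) ^ p with hF₁
    set F₀ := ∑ w : Cube n, f (Fin.cons false w) ^ p with hF₀
    have F₁0 : 0 ≤ F₁ := Finset.sum_nonneg fun w _ => Real.rpow_nonneg (hf _) _
    have F₀0 : 0 ≤ F₀ := Finset.sum_nonneg fun w _ => Real.rpow_nonneg (hf _) _
    have hKn : 0 ≤ K ^ n := pow_nonneg hK n
    have root : ∀ G F : ℝ, 0 ≤ G → 0 ≤ F → G ≤ K ^ n * F ^ (2 / p) →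
        G ^ (1 / (2 / p)) ≤ (K ^ n) ^ (1 / (2 / p)) * F := fun G F hG hF hGF => by
      refine (Real.rpow_le_rpow hG hGF (by positivity)).trans_eq ?_
      rw [Real.mul_rpow hKn (Real.rpow_nonneg hF _), ← Real.rpow_mul hF,
        mul_one_div_cancel hN0, Real.rpow_one]
    have mink := Real.Lp_add_le_of_nonneg (s := Finset.univ) (f := fun z => g₁ z ^ p)
      (g := fun z => g₀ z ^ p) hN (fun z _ => Real.rpow_nonneg (g₁0 z) p)
      (fun z _ => Real.rpow_nonneg (g₀0 z) p)
    simp only [hrp _ (g₁0 _), hrp _ (g₀0 _)] at mink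
    have r₁ := root _ _ (Finset.sum_nonneg fun z _ => sq_nonneg (g₁ z)) F₁0 i₁
    have r₀ := root _ _ (Finset.sum_nonneg fun z _ => sq_nonneg (g₀ z)) F₀0 i₀
    have hS0 : 0 ≤ ∑ z, (g₁ z ^ p + g₀ z ^ p) ^ (2 / p) := Finset.sum_nonneg fun z _ =>
      Real.rpow_nonneg (add_nonneg (Real.rpow_nonneg (g₁0 z) p) (Real.rpow_nonneg (g₀0 z) p)) _
    have key : ∑ z, (g₁ z ^ p + g₀ z ^ p) ^ (2 / p) ≤ K ^ n * (F₁ + F₀) ^ (2 / p) := by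
      have h2 := Real.rpow_le_rpow (Real.rpow_nonneg hS0 _)
        (mink.trans (add_le_add r₁ r₀)) (by positivity : (0 : ℝ) ≤ 2 / p)
      rwa [← Real.rpow_mul hS0, one_div_mul_cancel hN0, Real.rpow_one, ← mul_add,
        Real.mul_rpow (Real.rpow_nonneg hKn _) (add_nonneg F₁0 F₀0), ← Real.rpow_mul hKn,
        one_div_mul_cancel hN0, Real.rpow_one] at h2
    calc ∑ z, noise ε f z ^ 2
        = ∑ z, (((1 - ε) * g₁ z + ε * g₀ z) ^ 2 + ((1 - ε) * g₀ z + ε * g₁ z) ^ 2) := by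
          rw [sum_cube_succ, ← Finset.sum_add_distrib]
          refine Finset.sum_congr rfl fun z _ => ?_
          rw [noise_cons, noise_cons]
          rfl
      _ ≤ ∑ z, K * (g₁ z ^ p + g₀ z ^ p) ^ (2 / p) :=
          Finset.sum_le_sum fun z _ => h _ _ (g₁0 z) (g₀0 z)
      _ = K * ∑ z, (g₁ z ^ p + g₀ z ^ p) ^ (2 / p) := by rw [Finset.mul_sum]
      _ ≤ K * (K ^ n * (F₁ + F₀) ^ (2 / p)) := mul_le_mul_of_nonneg_left key hK
      _ = K ^ (n + 1) * (∑ z, f z ^ p) ^ (2 / p) := by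
          rw [sum_cube_succ (fun z => f z ^ p), pow_succ]; ring

lemma two_point_le {ε s β : ℝ} (hε : ε ∈ Icc (0 : ℝ) (1 / 2)) (hs : 0 < s)
    (hmax : ∀ z ∈ Icc (0 : ℝ) 1, phi ε z - s * z ≤ phi ε β - s * β) {a b : ℝ} (ha : 0 ≤ a)
    (hb : 0 ≤ b) : ((1 - ε) * a + ε * b) ^ 2 + ((1 - ε) * b + ε * a) ^ 2 ≤
      (2 : ℝ) ^ (2 * (phi ε β - s * β) + 1) * (a ^ (1 / s) + b ^ (1 / s)) ^ (2 / (1 / s)) := by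
  wlog hab : b ≤ a generalizing a b
  · rw [add_comm, add_comm (a ^ (1 / s))]
    exact this hb ha (le_of_not_ge hab)
  have hp : 0 < 1 / s := by positivity
  rcases ha.eq_or_lt with rfl | ha'
  · obtain rfl : b = 0 := le_antisymm hab hb
    simp only [mul_zero, add_zero, ne_eq, OfNat.ofNat_ne_zero, not_false_eq_true, zero_pow]
    positivity
  · obtain ⟨x, hx, hle⟩ := two_point (noiseParam_mem_Icc hε) hb hab ha' hp
    have hm := hmax x hx
    have e : ((1 - ε) * a + ε * b) ^ 2 + ((1 - ε) * b + ε * a) ^ 2 =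
        (1 - 2 * ε * (1 - ε)) * (a ^ 2 + b ^ 2) + 2 * (2 * ε * (1 - ε)) * (a * b) := by ring
    rw [e]
    have hN := noiseParam_mem_Icc hε
    have hZ : 0 < (1 - 2 * ε * (1 - ε)) * (a ^ 2 + b ^ 2) + 2 * (2 * ε * (1 - ε)) * (a * b) := by
      have h1 : 0 < 1 - 2 * ε * (1 - ε) := by linarith [hN.2]
      have h2 := hN.1
      positivity
    have hS : 0 < a ^ (1 / s) + b ^ (1 / s) := by positivity
    rw [← Real.log_le_log_iff hZ (by positivity), Real.log_mul (by positivity) (by positivity),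
      Real.log_rpow two_pos, Real.log_rpow hS]
    refine hle.trans ?_
    have e2 : 2 / (1 / s) = 2 * s := by field_simp
    rw [e2]
    have := mul_le_mul_of_nonneg_left hm log_two_pos.le
    have hphi : Phi x (2 * ε * (1 - ε)) = phi ε x := rfl
    rw [hphi]
    linarith

lemma sum_noise_sq_le_of_dual {ε s β : ℝ} (hε : ε ∈ Icc (0 : ℝ) (1 / 2)) (hs : 1 / 2 ≤ s)
    (hmax : ∀ z ∈ Icc (0 : ℝ) 1, phi ε z - s * z ≤ phi ε β - s * β) {n : ℕ} {f : Cube n → ℝ}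
    (hf : ∀ z, 0 ≤ f z) : ∑ z, noise ε f z ^ 2 ≤
      ((2 : ℝ) ^ (2 * (phi ε β - s * β) + 1)) ^ n * (∑ z, f z ^ (1 / s)) ^ (2 * s) := by
  have hs0 : 0 < s := by linarith
  have h := sum_noise_sq_le hε.1 (by linarith [hε.2]) (show 0 < 1 / s by positivity)
    (by rw [div_le_iff₀ hs0]; linarith) (by positivity)
    (fun a b ha hb => two_point_le hε hs0 hmax ha hb) n f hf
  rwa [show 2 / (1 / s) = 2 * s by field_simp] at h

/-! ### Rényi entropies -/

lemma mean_nonneg {n : ℕ} {f : Cube n → ℝ} (hf : ∀ z, 0 ≤ f z) : 0 ≤ mean f :=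
  div_nonneg (Finset.sum_nonneg fun z _ => hf z) (by positivity)

lemma renyiEnt_eq {n : ℕ} {q : ℝ} (hq : 1 < q) {f : Cube n → ℝ} (hf : ∀ z, 0 ≤ f z) :
    renyiEnt q f = 1 / (q - 1) * Real.logb 2 (mean fun z => f z ^ q) := by
  have h : lqNorm q f ^ q = mean fun z => f z ^ q := by
    simp only [lqNorm, abs_of_nonneg (hf _)]
    rw [← Real.rpow_mul (mean_nonneg fun z => Real.rpow_nonneg (hf z) q),
      one_div_mul_cancel (by linarith), Real.rpow_one]
  rw [renyiEnt, h]

lemma renyiEnt_two {n : ℕ} {f : Cube n → ℝ} (hf : ∀ z, 0 ≤ f z) :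
    renyiEnt 2 f = Real.logb 2 (mean fun z => f z ^ 2) := by
  rw [renyiEnt_eq one_lt_two hf]
  norm_num

lemma sum_eq_of_mean {n : ℕ} {f : Cube n → ℝ} {c : ℝ} (h : mean f = c) : ∑ z, f z = c * 2 ^ n := by
  rw [mean, div_eq_iff (by positivity)] at h
  exact h

lemma one_le_mean_rpow {n : ℕ} {q : ℝ} (hq : 1 ≤ q) {f : Cube n → ℝ} (hf : ∀ z, 0 ≤ f z)
    (h1 : mean f = 1) : 1 ≤ mean fun z => f z ^ q := by
  have h := Real.rpow_arith_mean_le_arith_mean_rpow Finset.univ (fun _ : Cube n => 1 / (2 : ℝ) ^ n)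
    f (fun _ _ => by positivity) (by simp) (fun z _ => hf z) hq
  have e : ∀ g : Cube n → ℝ, ∑ z, 1 / (2 : ℝ) ^ n * g z = mean g := fun g => by
    rw [mean, ← Finset.mul_sum]; ring
  rwa [e, e (fun z => f z ^ q), h1, Real.one_rpow] at h

lemma rpow_eq_mul_rpow_sub_one {x q : ℝ} (hx : 0 ≤ x) (hq : q ≠ 0) : x ^ q = x * x ^ (q - 1) := by
  have := Real.rpow_one_add' hx (y := q - 1) (by simpa using hq)
  rwa [add_sub_cancel] at this

lemma mean_rpow_le {n : ℕ} {q : ℝ} (hq : 1 ≤ q) {f : Cube n → ℝ} (hf : ∀ z, 0 ≤ f z)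
    (h1 : mean f = 1) : (mean fun z => f z ^ q) ≤ ((2 : ℝ) ^ n) ^ (q - 1) := by
  have hsum := sum_eq_of_mean h1
  rw [one_mul] at hsum
  rw [mean, div_le_iff₀ (by positivity)]
  calc ∑ z, f z ^ q ≤ ∑ z, f z * ((2 : ℝ) ^ n) ^ (q - 1) := by
        refine Finset.sum_le_sum fun z _ => ?_
        rw [rpow_eq_mul_rpow_sub_one (hf z) (by linarith)]
        refine mul_le_mul_of_nonneg_left (Real.rpow_le_rpow (hf z) ?_ (by linarith)) (hf z)
        rw [← hsum]
        exact Finset.single_le_sum (fun y _ => hf y) (Finset.mem_univ z)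
    _ = _ := by rw [← Finset.sum_mul, hsum, mul_comm]

lemma renyiEnt_div_mem {n : ℕ} (hn : 0 < n) {q : ℝ} (hq : 1 < q) {f : Cube n → ℝ}
    (hf : ∀ z, 0 ≤ f z) (h1 : mean f = 1) : renyiEnt q f / n ∈ Icc (0 : ℝ) 1 := by
  have l := one_le_mean_rpow hq.le hf h1
  have u := mean_rpow_le hq.le hf h1
  have hq0 : 0 < q - 1 := by linarith
  have hn' : (0 : ℝ) < n := by exact_mod_cast hn
  have hl := Real.logb_nonneg one_lt_two l
  have hu := Real.logb_le_logb_of_le one_lt_two (by linarith) u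
  rw [Real.logb_rpow_eq_mul_logb_of_pos (by positivity), Real.logb_pow,
    Real.logb_self_eq_one one_lt_two, mul_one] at hu
  rw [renyiEnt_eq hq hf]
  refine ⟨by positivity, ?_⟩
  rw [div_le_one hn', one_div, inv_mul_le_iff₀ hq0]
  exact hu

/-- Monotonicity of Rényi entropies in the order. -/
lemma logb_mean_rpow_le {n : ℕ} {p q : ℝ} (hp : 1 ≤ p) (hpq : p ≤ q) (hq : 1 < q) {f : Cube n → ℝ}
    (hf : ∀ z, 0 ≤ f z) (h1 : mean f = 1) :
    Real.logb 2 (mean fun z => f z ^ p) ≤ (p - 1) * renyiEnt q f := by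
  rcases hp.eq_or_lt with rfl | hp1
  · simp only [Real.rpow_one, h1, Real.logb_one, sub_self, zero_mul, le_refl]
  have hp0 : 0 < p - 1 := by linarith
  have hq0 : 0 < q - 1 := by linarith
  have hsum := sum_eq_of_mean h1
  rw [one_mul] at hsum
  have h := Real.rpow_arith_mean_le_arith_mean_rpow Finset.univ (fun z => f z / (2 : ℝ) ^ n)
    (fun z => f z ^ (p - 1)) (fun z _ => div_nonneg (hf z) (by positivity))
    (by rw [← Finset.sum_div, hsum, div_self (by positivity)])
    (fun z _ => Real.rpow_nonneg (hf z) _) (show 1 ≤ (q - 1) / (p - 1) by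
      rw [le_div_iff₀ hp0]; linarith)
  have e : ∀ r : ℝ, r ≠ 0 → ∑ z, f z / (2 : ℝ) ^ n * f z ^ (r - 1) = mean fun z => f z ^ r := by
    intro r hr
    rw [mean, Finset.sum_div]
    refine Finset.sum_congr rfl fun z _ => ?_
    rw [rpow_eq_mul_rpow_sub_one (hf z) hr]; ring
  have e2 : ∀ z, (f z ^ (p - 1)) ^ ((q - 1) / (p - 1)) = f z ^ (q - 1) := fun z => by
    rw [← Real.rpow_mul (hf z), mul_div_cancel₀ _ hp0.ne']
  simp only [e2] at h
  rw [e p (by linarith), e q (by linarith)] at h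
  have hP : 0 < mean fun z => f z ^ p := by linarith [one_le_mean_rpow hp hf h1]
  have h2 := Real.logb_le_logb_of_le one_lt_two (Real.rpow_pos_of_pos hP _) h
  rw [Real.logb_rpow_eq_mul_logb_of_pos hP, div_mul_eq_mul_div, div_le_iff₀ hp0] at h2
  rw [renyiEnt_eq hq hf, one_div, ← mul_assoc, mul_comm (p - 1), mul_assoc, ← div_eq_inv_mul,
    le_div_iff₀ hq0]
  linarith

lemma mean_noise_sq_pos {n : ℕ} {ε : ℝ} (hε : ε ∈ Icc (0 : ℝ) (1 / 2)) {f : Cube n → ℝ}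
    (hf : ∀ z, 0 ≤ f z) (h1 : mean f = 1) : 0 < mean fun z => noise ε f z ^ 2 := by
  obtain ⟨z, -, hz⟩ : ∃ z ∈ Finset.univ, 0 < f z := by
    apply Finset.exists_lt_of_sum_lt
    rw [sum_eq_of_mean h1]
    simp
  refine div_pos (Finset.sum_pos' (fun z _ => sq_nonneg _) ⟨z, Finset.mem_univ z, ?_⟩)
    (by positivity)
  refine pow_pos (lt_of_lt_of_le (mul_pos (pow_pos ?_ n) hz)
    (pow_mul_le_noise hε.1 (by linarith [hε.2]) hf z)) 2
  linarith [hε.2]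

theorem renyiEnt_noise_le {q ε : ℝ} (hq : 1 < q) (hε : ε ∈ Icc (0 : ℝ) (1 / 2)) {n : ℕ}
    (hn : 0 < n) {f : Cube n → ℝ} (hf : ∀ z, 0 ≤ f z) (h1 : mean f = 1) :
    renyiEnt 2 (noise ε f) / n ≤ psi q (renyiEnt q f / n) ε := by
  have hn' : (0 : ℝ) < n := by exact_mod_cast hn
  obtain ⟨s, β, hs2, hsq, hs1, -, -, -, hmax, -, -, e⟩ :=
    psi_repr hq hε (renyiEnt_div_mem hn hq hf h1)
  have hs0 : 0 < s := by linarith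
  have hp1 : 1 ≤ 1 / s := by rwa [le_div_iff₀ hs0, one_mul]
  have hpq : 1 / s ≤ q := by
    rw [div_le_iff₀ hs0]
    rwa [div_le_iff₀ (by linarith), mul_comm] at hsq
  have hT := sum_noise_sq_le_of_dual hε hs2 hmax hf
  have hR := logb_mean_rpow_le hp1 hpq hq hf h1
  have hP : 0 < mean fun z => f z ^ (1 / s) := by linarith [one_le_mean_rpow hp1 hf h1]
  have hsumP := sum_eq_of_mean (rfl : (mean fun z => f z ^ (1 / s)) = _)
  have hpos := mean_noise_sq_pos hε hf h1
  have hle : (mean fun z => noise ε f z ^ 2) ≤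
      ((2 : ℝ) ^ (2 * (phi ε β - s * β) + 1)) ^ n *
        ((mean fun z => f z ^ (1 / s)) * 2 ^ n) ^ (2 * s) / 2 ^ n := by
    rw [← hsumP]
    exact div_le_div_of_nonneg_right hT (by positivity)
  have hlog := Real.logb_le_logb_of_le one_lt_two hpos hle
  rw [Real.logb_div (by positivity) (by positivity), Real.logb_mul (by positivity) (by positivity),
    Real.logb_pow, Real.logb_rpow two_pos (by norm_num),
    Real.logb_rpow_eq_mul_logb_of_pos (by positivity), Real.logb_mul hP.ne' (by positivity),
    Real.logb_pow, Real.logb_self_eq_one one_lt_two, mul_one] at hlog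
  rw [renyiEnt_two (noise_nonneg hε.1 (by linarith [hε.2]) hf), e, div_le_iff₀ hn']
  have h3 := mul_le_mul_of_nonneg_left hR (show 0 ≤ 2 * s by linarith)
  have h4 : 2 * s * ((1 / s - 1) * renyiEnt q f) = 2 * (1 - s) * renyiEnt q f := by
    field_simp
  have h5 : (1 - s) * (renyiEnt q f / n) * n = (1 - s) * renyiEnt q f := by
    field_simp
  linarith

/-! ### Product functions and Hamming spheres -/

/-- The tensor power of the two-point function with values `a` at `0` and `1` at `1`. -/
noncomputable def tensorPow (a : ℝ) {n : ℕ} (z : Cube n) : ℝ := ∏ i, if z i = true then 1 else a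

/-- The indicator of the Hamming sphere of radius `r` around `0`. -/
noncomputable def sphereInd (n r : ℕ) : Cube n → ℝ :=
  (hammingSphere (fun _ => false : Cube n) r : Set (Cube n)).indicator 1

lemma tensorPow_cons (a : ℝ) {n : ℕ} (u : Bool) (z : Cube n) :
    tensorPow a (Fin.cons u z : Cube (n + 1)) = (if u = true then 1 else a) * tensorPow a z := by
  simp only [tensorPow]
  rw [Fin.prod_univ_succ]
  simp only [Fin.cons_zero, Fin.cons_succ]

lemma tensorPow_eq_pow (a : ℝ) {n : ℕ} (z : Cube n) :
    tensorPow a z = a ^ (n - hammingDist z fun _ => false) := by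
  have h := Finset.card_filter_add_card_filter_not (s := Finset.univ) (fun i => z i = true)
  have e : (hammingDist z fun _ => false) = (Finset.univ.filter fun i => z i = true).card := by
    simp [hammingDist]
  rw [Finset.card_univ, Fintype.card_fin] at h
  rw [tensorPow, Finset.prod_ite, Finset.prod_const_one, one_mul, Finset.prod_const, e]
  congr 1
  omega

lemma noise_const_mul {n : ℕ} (ε c : ℝ) (f : Cube n → ℝ) (z : Cube n) :
    noise ε (fun w => c * f w) z = c * noise ε f z := by
  simp only [noise, Finset.mul_sum]
  exact Finset.sum_congr rfl fun y _ => by ring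

lemma noise_sum {n : ℕ} {ι : Type*} (ε : ℝ) (s : Finset ι) (f : ι → Cube n → ℝ) (z : Cube n) :
    noise ε (fun w => ∑ k ∈ s, f k w) z = ∑ k ∈ s, noise ε (f k) z := by
  simp only [noise, Finset.mul_sum]
  exact Finset.sum_comm

lemma sum_noise_tensorPow_sq (ε a : ℝ) (n : ℕ) :
    ∑ z : Cube n, noise ε (tensorPow a) z ^ 2 =
      ((1 - 2 * ε * (1 - ε)) * (a ^ 2 + 1) + 2 * (2 * ε * (1 - ε)) * a) ^ n := by
  induction n with
  | zero => simp [noise, tensorPow]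
  | succ n ih =>
    rw [sum_cube_succ, pow_succ, ← ih, ← Finset.sum_add_distrib, Finset.sum_mul]
    refine Finset.sum_congr rfl fun z _ => ?_
    simp only [noise_cons, tensorPow_cons, noise_const_mul, Bool.not_true, Bool.not_false,
      if_true, reduceCtorEq, if_false]
    ring

lemma sum_tensorPow_rpow {a : ℝ} (ha : 0 < a) (r : ℝ) (n : ℕ) :
    ∑ z : Cube n, tensorPow a z ^ r = (a ^ r + 1) ^ n := by
  induction n with
  | zero => simp [tensorPow]
  | succ n ih =>
    have hpos : ∀ z : Cube n, 0 ≤ tensorPow a z := fun z => by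
      rw [tensorPow_eq_pow]; positivity
    rw [sum_cube_succ, pow_succ, ← ih, ← Finset.sum_add_distrib, Finset.sum_mul]
    refine Finset.sum_congr rfl fun z _ => ?_
    simp only [tensorPow_cons, if_true, reduceCtorEq, if_false, one_mul,
      Real.mul_rpow ha.le (hpos z)]
    ring

lemma sphereInd_apply {n r : ℕ} (z : Cube n) :
    sphereInd n r z = if hammingDist z (fun _ => false) = r then 1 else 0 := by
  simp [sphereInd, Set.indicator_apply, hammingSphere]

lemma sphereInd_nonneg {n r : ℕ} (z : Cube n) : 0 ≤ sphereInd n r z := by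
  rw [sphereInd_apply]; split_ifs <;> norm_num

lemma sum_sphereInd (n r : ℕ) : ∑ z, sphereInd n r z =
    ((hammingSphere (fun _ => false : Cube n) r).card : ℝ) := by
  simp only [sphereInd_apply, hammingSphere, Finset.sum_boole]

lemma sphereInd_rpow {n r : ℕ} {p : ℝ} (hp : p ≠ 0) (z : Cube n) :
    sphereInd n r z ^ p = sphereInd n r z := by
  rw [sphereInd_apply]; split_ifs <;> simp [hp]

lemma tensorPow_eq_sum (a : ℝ) {n : ℕ} (z : Cube n) :
    tensorPow a z = ∑ k ∈ Finset.range (n + 1), a ^ (n - k) * sphereInd n k z := by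
  rw [Finset.sum_eq_single (hammingDist z fun _ => false), sphereInd_apply, if_pos rfl, mul_one,
    tensorPow_eq_pow]
  · intro k _ hk
    rw [sphereInd_apply, if_neg hk.symm, mul_zero]
  · intro h
    exact absurd (Finset.mem_range.2 (Nat.lt_succ_of_le (hammingDist_le z _))) h

lemma exists_sphere_noise (ε a : ℝ) (n : ℕ) : ∃ k ≤ n,
    ((1 - 2 * ε * (1 - ε)) * (a ^ 2 + 1) + 2 * (2 * ε * (1 - ε)) * a) ^ n ≤
      (n + 1) ^ 2 * ((a ^ (n - k)) ^ 2 * ∑ z, noise ε (sphereInd n k) z ^ 2) := by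
  rw [← sum_noise_tensorPow_sq]
  have hsum : ∀ z : Cube n, noise ε (tensorPow a) z =
      ∑ k ∈ Finset.range (n + 1), a ^ (n - k) * noise ε (sphereInd n k) z := fun z => by
    have : (tensorPow a : Cube n → ℝ) = fun w =>
        ∑ k ∈ Finset.range (n + 1), a ^ (n - k) * sphereInd n k w := funext (tensorPow_eq_sum a)
    rw [this, noise_sum]
    exact Finset.sum_congr rfl fun k _ => noise_const_mul _ _ _ _
  have h1 : ∑ z : Cube n, noise ε (tensorPow a) z ^ 2 ≤ ∑ k ∈ Finset.range (n + 1),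
      ((n : ℝ) + 1) * ((a ^ (n - k)) ^ 2 * ∑ z, noise ε (sphereInd n k) z ^ 2) := by
    calc ∑ z : Cube n, noise ε (tensorPow a) z ^ 2
        ≤ ∑ z : Cube n, ((n : ℝ) + 1) * ∑ k ∈ Finset.range (n + 1),
            (a ^ (n - k) * noise ε (sphereInd n k) z) ^ 2 := by
          refine Finset.sum_le_sum fun z _ => ?_
          rw [hsum z]
          simpa using sq_sum_le_card_mul_sum_sq (s := Finset.range (n + 1))
            (f := fun k => a ^ (n - k) * noise ε (sphereInd n k) z)
      _ = _ := by
          rw [← Finset.mul_sum, Finset.sum_comm, ← Finset.mul_sum]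
          congr 1
          refine Finset.sum_congr rfl fun k _ => ?_
          rw [Finset.mul_sum]
          exact Finset.sum_congr rfl fun z _ => by ring
  by_contra! hcon
  have h2 := Finset.sum_lt_sum_of_nonempty (s := Finset.range (n + 1)) ⟨0, by simp⟩
    (f := fun k => ((n : ℝ) + 1) * ((a ^ (n - k)) ^ 2 * ∑ z, noise ε (sphereInd n k) z ^ 2))
    (g := fun _ => (∑ z : Cube n, noise ε (tensorPow a) z ^ 2) / (n + 1)) (fun k hk => by
      rw [lt_div_iff₀ (by positivity)]
      have := hcon k (Nat.lt_succ_iff.1 (Finset.mem_range.1 hk))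
      linarith)
  rw [Finset.sum_const, Finset.card_range, nsmul_eq_mul] at h2
  push_cast at h2
  rw [mul_div_cancel₀ _ (by positivity)] at h2
  linarith

/-- The normalized logarithm of the size of a Hamming sphere. -/
noncomputable def sphereRate (n r : ℕ) : ℝ :=
  Real.logb 2 ((hammingSphere (fun _ => false : Cube n) r).card : ℝ) / n

lemma sphereRate_mem {n r : ℕ} (hn : 0 < n)
    (hS : 0 < (hammingSphere (fun _ => false : Cube n) r).card) :
    sphereRate n r ∈ Icc (0 : ℝ) 1 := by
  have hn' : (0 : ℝ) < n := by exact_mod_cast hn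
  have hS1 : (1 : ℝ) ≤ (hammingSphere (fun _ => false : Cube n) r).card := by exact_mod_cast hS
  have hS2 : ((hammingSphere (fun _ => false : Cube n) r).card : ℝ) ≤ 2 ^ n := by
    have := Finset.card_le_univ (hammingSphere (fun _ => false : Cube n) r)
    rw [Fintype.card_fun, Fintype.card_bool, Fintype.card_fin] at this
    exact_mod_cast this
  have h := Real.logb_le_logb_of_le one_lt_two (by linarith) hS2
  rw [Real.logb_pow, Real.logb_self_eq_one one_lt_two, mul_one] at h
  exact ⟨div_nonneg (Real.logb_nonneg one_lt_two hS1) hn'.le, (div_le_one hn').2 h⟩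

lemma logb_card_sphere {n r : ℕ} (hn : 0 < n) :
    Real.logb 2 ((hammingSphere (fun _ => false : Cube n) r).card : ℝ) = n * sphereRate n r := by
  have hn' : (n : ℝ) ≠ 0 := by exact_mod_cast hn.ne'
  rw [sphereRate, mul_div_cancel₀ _ hn']

lemma sum_noise_sphereInd_sq_pos {ε : ℝ} (hε : ε ∈ Icc (0 : ℝ) (1 / 2)) {n r : ℕ}
    (hS : 0 < (hammingSphere (fun _ => false : Cube n) r).card) :
    0 < ∑ z, noise ε (sphereInd n r) z ^ 2 := by
  obtain ⟨z, hz⟩ := Finset.card_pos.1 hS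
  have hz1 : sphereInd n r z = 1 := by
    rw [sphereInd_apply, if_pos (Finset.mem_filter.1 hz).2]
  refine Finset.sum_pos' (fun z _ => sq_nonneg _) ⟨z, Finset.mem_univ z, ?_⟩
  have h := pow_mul_le_noise hε.1 (by linarith [hε.2]) sphereInd_nonneg z (n := n)
    (f := sphereInd n r)
  rw [hz1, mul_one] at h
  exact pow_pos (lt_of_lt_of_le (pow_pos (by linarith [hε.2]) n) h) 2

/-- Hamming spheres have noise stability at most that predicted by `φ_ε`. -/
lemma logb_noise_sphere_le {ε : ℝ} (hε : ε ∈ Icc (0 : ℝ) (1 / 2)) {n r : ℕ} (hn : 0 < n)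
    (hS : 0 < (hammingSphere (fun _ => false : Cube n) r).card) :
    Real.logb 2 (∑ z, noise ε (sphereInd n r) z ^ 2) ≤ n * (2 * phi ε (sphereRate n r) + 1) := by
  have hx := sphereRate_mem hn hS
  have hs := half_le_phi' hε hx
  have hs0 : 0 < phi' ε (sphereRate n r) := by linarith
  have h := sum_noise_sq_le_of_dual hε hs (fun z hz => phi_le_tangent hε hx hz)
    (f := sphereInd n r) sphereInd_nonneg
  simp only [sphereInd_rpow (one_div_pos.2 hs0).ne'] at h
  rw [sum_sphereInd] at h
  have hS' : (0 : ℝ) < (hammingSphere (fun _ => false : Cube n) r).card := by exact_mod_cast hS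
  have hlog := Real.logb_le_logb_of_le one_lt_two (sum_noise_sphereInd_sq_pos hε hS) h
  rw [Real.logb_mul (by positivity) (by positivity), Real.logb_pow,
    Real.logb_rpow two_pos (by norm_num), Real.logb_rpow_eq_mul_logb_of_pos hS',
    logb_card_sphere hn] at hlog
  linarith

/-- Some Hamming sphere almost attains the tangent bound at a given interior point. -/
lemma exists_sphere_le_logb_noise {ε β : ℝ} (hε : ε ∈ Ioo (0 : ℝ) (1 / 2))
    (hβ : β ∈ Ioo (0 : ℝ) 1) {n : ℕ} (hn : 0 < n) : ∃ r ≤ n,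
      0 < (hammingSphere (fun _ => false : Cube n) r).card ∧
      n * (2 * (phi ε β - phi' ε β * β + phi' ε β * sphereRate n r) + 1) -
        2 * Real.logb 2 (n + 1) ≤ Real.logb 2 (∑ z, noise ε (sphereInd n r) z ^ 2) := by
  have hε' : ε ∈ Icc (0 : ℝ) (1 / 2) := Ioo_subset_Icc_self hε
  have hδ := noiseParam_mem_Ioo hε
  obtain ⟨a, ha, hZ⟩ := two_point_eq hδ hβ
  have hs : phi' ε β = dualSlope (2 * ε * (1 - ε)) (Hinv β) := derivWithin_Phi hδ hβ
  have hs0 : 0 < phi' ε β := by linarith [half_le_phi' hε' (Ioo_subset_Icc_self hβ)]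
  rw [← hs] at hZ
  have hphi : Phi β (2 * ε * (1 - ε)) = phi ε β := rfl
  rw [hphi] at hZ
  obtain ⟨k, hk, hle⟩ := exists_sphere_noise ε a n
  set Z := (1 - 2 * ε * (1 - ε)) * (a ^ 2 + 1) + 2 * (2 * ε * (1 - ε)) * a with hZdef
  have hZ0 : 0 < Z := by
    have h1 : 0 < 1 - 2 * ε * (1 - ε) := by linarith [hδ.2]
    have h2 := hδ.1
    positivity
  have hS : 0 < (hammingSphere (fun _ => false : Cube n) k).card := by
    by_contra! h0
    have hc : hammingSphere (fun _ => false : Cube n) k = ∅ :=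
      Finset.card_eq_zero.1 (Nat.le_zero.1 h0)
    have : sphereInd n k = fun _ => 0 := by
      funext z; simp [sphereInd, hc]
    rw [this] at hle
    simp only [noise, mul_zero, Finset.sum_const_zero, ne_eq, OfNat.ofNat_ne_zero,
      not_false_eq_true, zero_pow] at hle
    linarith [pow_pos hZ0 n]
  refine ⟨k, hk, hS, ?_⟩
  have hS' : (0 : ℝ) < (hammingSphere (fun _ => false : Cube n) k).card := by exact_mod_cast hS
  have hQ := sum_noise_sphereInd_sq_pos hε' hS
  set r := 1 / phi' ε β with hr
  have hN : (hammingSphere (fun _ => false : Cube n) k).card * (a ^ (n - k)) ^ r ≤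
      (a ^ r + 1) ^ n := by
    rw [← sum_tensorPow_rpow ha, ← sum_sphereInd, Finset.sum_mul]
    refine Finset.sum_le_sum fun z _ => ?_
    rw [sphereInd_apply]
    split_ifs with h
    · rw [one_mul, tensorPow_eq_pow, h]
    · rw [zero_mul, tensorPow_eq_pow]; positivity
  have hA : 0 < a ^ (n - k) := by positivity
  have l1 := Real.log_le_log (by positivity) hle
  have l2 := Real.log_le_log (by positivity) hN
  rw [Real.log_mul (by positivity) (by positivity), Real.log_mul (by positivity) hQ.ne',
    Real.log_pow, Real.log_pow, Real.log_pow (n := 2), hZ] at l1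
  rw [Real.log_mul hS'.ne' (by positivity), Real.log_rpow hA, Real.log_pow (a ^ r + 1)] at l2
  have l3 := mul_le_mul_of_nonneg_left l2 hs0.le
  have e1 : phi' ε β * (Real.log ((hammingSphere (fun _ => false : Cube n) k).card : ℝ) +
      r * Real.log (a ^ (n - k))) =
      phi' ε β * Real.log ((hammingSphere (fun _ => false : Cube n) k).card : ℝ) +
        Real.log (a ^ (n - k)) := by
    rw [hr]; field_simp
  rw [e1] at l3
  have l4 := logb_card_sphere (r := k) hn
  have hl := log_two_pos
  rw [Real.logb, div_eq_iff hl.ne'] at l4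
  rw [l4] at l3
  rw [Real.logb, Real.logb, le_div_iff₀ hl]
  have e2 : Real.log ((n : ℝ) + 1) / Real.log 2 * Real.log 2 = Real.log ((n : ℝ) + 1) :=
    div_mul_cancel₀ _ hl.ne'
  push_cast at l1
  linear_combination l1 + 2 * l3 - 2 * e2

lemma exists_gap {ε β η : ℝ} (hε : ε ∈ Ioo (0 : ℝ) (1 / 2)) (hβ : β ∈ Icc (0 : ℝ) 1)
    (hη : 0 < η) : ∃ c > 0, ∀ x ∈ Icc (0 : ℝ) 1,
      phi ε β - phi' ε β * β < phi ε x - phi' ε β * x + c → |x - β| < η := by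
  have hc : IsCompact (Icc (0 : ℝ) 1 ∩ {x | η ≤ |x - β|}) :=
    isCompact_Icc.inter_right (isClosed_le continuous_const (by fun_prop))
  rcases (Icc (0 : ℝ) 1 ∩ {x | η ≤ |x - β|}).eq_empty_or_nonempty with he | hne
  · refine ⟨1, one_pos, fun x hx _ => ?_⟩
    by_contra! h
    have : x ∈ Icc (0 : ℝ) 1 ∩ {x | η ≤ |x - β|} := ⟨hx, h⟩
    rw [he] at this
    exact this
  · obtain ⟨w, hw, hmax⟩ := hc.exists_isMaxOn hne (f := fun x => phi ε x - phi' ε β * x)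
      ((((differentiableOn_phi (Ioo_subset_Icc_self hε)).continuousOn).sub
        (continuousOn_const.mul continuousOn_id)).mono inter_subset_left)
    have hlt := phi_lt_tangent hε hβ hw.1 (fun h => by
      have := hw.2
      rw [h, mem_ofPred_eq, sub_self, abs_zero] at this
      linarith)
    refine ⟨_, sub_pos.2 hlt, fun x hx h => ?_⟩
    by_contra! h'
    have := hmax (show x ∈ Icc (0 : ℝ) 1 ∩ {x | η ≤ |x - β|} from ⟨hx, h'⟩)
    simp only [mem_ofPred_eq] at this
    linarith

lemma tendsto_logb_div : Tendsto (fun n : ℕ => Real.logb 2 ((n : ℝ) + 1) / n) atTop (𝓝 0) := by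
  have h := (tendsto_pow_log_div_mul_add_atTop 1 (-1) 1 one_ne_zero).comp
    (tendsto_atTop_add_const_right atTop (1 : ℝ) tendsto_natCast_atTop_atTop)
  have h2 := h.div_const (Real.log 2)
  rw [zero_div] at h2
  refine h2.congr fun n => ?_
  simp only [Function.comp_apply, pow_one, Real.logb]
  rw [div_right_comm]
  congr 2
  ring

/-! ### Mixtures -/

lemma sphereMix_apply (n r : ℕ) (l : ℝ) (z : Cube n) : sphereMix n r l z = (1 - l) +
    l * (2 ^ n / ((hammingSphere (fun _ => false : Cube n) r).card : ℝ)) * sphereInd n r z := by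
  rw [sphereMix, sphereInd, mul_one, mul_assoc]

lemma sphereMix_nonneg {n r : ℕ} {l : ℝ} (hl : l ∈ Icc (0 : ℝ) 1) (z : Cube n) :
    0 ≤ sphereMix n r l z := by
  have h1 := hl.1
  have h2 := sphereInd_nonneg (r := r) z
  have h3 : 0 ≤ 1 - l := by linarith [hl.2]
  rw [sphereMix_apply]
  positivity

lemma mean_sphereMix {n r : ℕ} (hS : 0 < (hammingSphere (fun _ => false : Cube n) r).card)
    (l : ℝ) : mean (sphereMix n r l) = 1 := by
  have hS' : (0 : ℝ) < (hammingSphere (fun _ => false : Cube n) r).card := by exact_mod_cast hS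
  simp only [mean, sphereMix_apply]
  rw [Finset.sum_add_distrib, ← Finset.mul_sum, sum_sphereInd, Finset.sum_const, Finset.card_univ,
    Fintype.card_fun, Fintype.card_bool, Fintype.card_fin, nsmul_eq_mul]
  push_cast
  field_simp
  ring

theorem exists_sphereMix {q x ε y : ℝ} (hq : 1 < q) (hx : x ∈ Ioo (0 : ℝ) 1)
    (hε : ε ∈ Ioo (0 : ℝ) (1 / 2)) (hy : y < psi q x ε) (n₀ : ℕ) : ∃ n : ℕ, n₀ ≤ n ∧ 0 < n ∧
      ∃ f : Cube n → ℝ, (∀ z, 0 ≤ f z) ∧ mean f = 1 ∧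
        (∃ r ≤ n, ∃ l ∈ Icc (0 : ℝ) 1, f = sphereMix n r l) ∧
        renyiEnt q f / n ≤ x ∧ y < renyiEnt 2 (noise ε f) / n := by
  have hε' : ε ∈ Icc (0 : ℝ) (1 / 2) := Ioo_subset_Icc_self hε
  have hq0 : 0 < q - 1 := by linarith
  obtain ⟨s, β, hs2, hsq, -, hβ, hβx, hor, -, hs1, hsβ, e⟩ :=
    psi_repr hq hε' (Ioo_subset_Icc_self hx)
  have hs1 := hs1 hε.2 hx.2
  have hsβ := hsβ hε.1
  have hβ' : β ∈ Ioo (0 : ℝ) 1 := by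
    refine ⟨lt_of_le_of_ne hβ.1 fun h => ?_, by linarith [hx.1]⟩
    rw [← h, phi'_at_zero ⟨hε.1, hε.2.le⟩] at hsβ
    linarith
  obtain ⟨α, hα⟩ : ∃ α, α = (1 - β) * s + (1 - s) * x := ⟨_, rfl⟩
  have hα0 : 0 < α := by
    rw [hα]
    have h1 : 0 < 1 - β := by linarith [hβ'.2]
    have h2 : 0 < 1 - s := by linarith
    have h3 := hx.1
    positivity
  have hαβ : α + β - 1 ≤ 0 := by
    have : α + β - 1 = (1 - s) * (x + β - 1) := by rw [hα]; ring
    rw [this]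
    exact mul_nonpos_of_nonneg_of_nonpos (by linarith) (by linarith)
  have hqα : q * α + β - 1 = (q - 1) * x := by
    rcases hor with h | h
    · rw [hα, h]; field_simp; ring
    · rw [hα, h]; ring
  have hpsi : psi q x ε = 2 * (phi ε β + α) := by rw [e, hα]; ring
  obtain ⟨η, hη0, hηα, hηx, hηy⟩ : ∃ η > 0, η ≤ α ∧ η ≤ x ∧ 8 * η ≤ psi q x ε - y :=
    ⟨min (min α x) ((psi q x ε - y) / 8),
      lt_min (lt_min hα0 hx.1) (div_pos (sub_pos.2 hy) (by norm_num)),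
      (min_le_left _ _).trans (min_le_left _ _), (min_le_left _ _).trans (min_le_right _ _), by
        linarith [min_le_right (min α x) ((psi q x ε - y) / 8)]⟩
  obtain ⟨c, hc0, hc⟩ := exists_gap hε hβ hη0
  have ev1 := tendsto_logb_div.eventually (gt_mem_nhds hc0)
  have ev2 := tendsto_logb_div.eventually (gt_mem_nhds hη0)
  have ev3 := (tendsto_natCast_atTop_atTop (R := ℝ)).eventually_ge_atTop
    (Real.logb 2 (1 + 2 ^ q) / ((q - 1) * η))
  obtain ⟨n, h1, h2, h3, hn0, hn⟩ :=
    (ev1.and (ev2.and (ev3.and ((eventually_ge_atTop n₀).and (eventually_gt_atTop 0))))).exists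
  have hn' : (0 : ℝ) < n := by exact_mod_cast hn
  obtain ⟨r, hr, hS, hlow⟩ := exists_sphere_le_logb_noise hε hβ' hn
  have hup := logb_noise_sphere_le hε' hn hS
  have hxr := sphereRate_mem hn hS
  have hS' : (0 : ℝ) < (hammingSphere (fun _ => false : Cube n) r).card := by exact_mod_cast hS
  have hQ := sum_noise_sphereInd_sq_pos hε' hS
  have hcard := logb_card_sphere (r := r) hn
  rw [Real.logb_eq_iff_rpow_eq two_pos (by norm_num) hS'] at hcard
  set X := sphereRate n r
  set N : ℝ := ((hammingSphere (fun _ => false : Cube n) r).card : ℝ)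
  set L := Real.logb 2 ((n : ℝ) + 1)
  rw [div_lt_iff₀ hn'] at h1 h2
  rw [div_le_iff₀ (by positivity)] at h3
  have hnear : |X - β| < η := by
    refine hc X hxr ?_
    have : (n : ℝ) * (phi ε β - phi' ε β * β) < n * (phi ε X - phi' ε β * X + c) := by linarith
    exact lt_of_mul_lt_mul_left this hn'.le
  rw [hsβ] at hlow
  obtain ⟨hX1, hX2⟩ := abs_lt.1 hnear
  have h2n : (2 : ℝ) ^ n = 2 ^ (n : ℝ) := (Real.rpow_natCast 2 n).symm
  obtain ⟨A, hA⟩ : ∃ A : ℝ, A = 2 ^ (n * (α - η)) := ⟨_, rfl⟩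
  have hA0 : 0 < A := hA ▸ Real.rpow_pos_of_pos two_pos _
  have hA1 : 1 ≤ A := hA ▸ Real.one_le_rpow one_le_two (mul_nonneg hn'.le (by linarith))
  have hmass : ∀ p : ℝ, A ^ p * N / 2 ^ n = 2 ^ (n * (p * (α - η) + X - 1)) := fun p => by
    rw [hA, ← hcard, h2n, ← Real.rpow_mul two_pos.le, ← Real.rpow_add two_pos,
      ← Real.rpow_sub two_pos]
    congr 1; ring
  obtain ⟨l, hl⟩ : ∃ l, l = A * N / 2 ^ n := ⟨_, rfl⟩
  have hlmem : l ∈ Icc (0 : ℝ) 1 := by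
    refine ⟨by rw [hl]; positivity, ?_⟩
    have := hmass 1
    rw [Real.rpow_one] at this
    rw [hl, this]
    exact Real.rpow_le_one_of_one_le_of_nonpos one_le_two
      (mul_nonpos_of_nonneg_of_nonpos hn'.le (by linarith))
  have hval : ∀ z : Cube n, sphereMix n r l z = (1 - l) + A * sphereInd n r z := fun z => by
    rw [sphereMix_apply, hl]
    congr 2
    change A * N / 2 ^ n * (2 ^ n / N) = A
    field_simp
  have hf0 := fun z : Cube n => sphereMix_nonneg (r := r) hlmem z
  have hf1 := mean_sphereMix hS l
  refine ⟨n, hn0, hn, sphereMix n r l, hf0, hf1, ⟨r, hr, l, hlmem, rfl⟩, ?_, ?_⟩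
  · have hpt : ∀ z : Cube n, sphereMix n r l z ^ q ≤ 1 + 2 ^ q * A ^ q * sphereInd n r z := by
      intro z
      have h0 := hf0 z
      rw [hval] at h0 ⊢
      rw [sphereInd_apply] at h0 ⊢
      split_ifs at h0 ⊢
      · rw [mul_one, mul_one, ← Real.mul_rpow two_pos.le hA0.le]
        rw [mul_one] at h0
        have : (1 - l + A) ^ q ≤ (2 * A) ^ q :=
          Real.rpow_le_rpow h0 (by linarith [hlmem.1]) (by linarith)
        linarith
      · rw [mul_zero, mul_zero, add_zero, add_zero]
        rw [mul_zero, add_zero] at h0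
        exact Real.rpow_le_one h0 (by linarith [hlmem.1]) (by linarith)
    have hmean : (mean fun z => sphereMix n r l z ^ q) ≤ 1 + 2 ^ q * (A ^ q * N / 2 ^ n) := by
      rw [mean, div_le_iff₀ (by positivity)]
      refine (Finset.sum_le_sum fun z _ => hpt z).trans_eq ?_
      rw [Finset.sum_add_distrib, ← Finset.mul_sum, sum_sphereInd, Finset.sum_const,
        Finset.card_univ, Fintype.card_fun, Fintype.card_bool, Fintype.card_fin, nsmul_eq_mul]
      push_cast
      field_simp
      rfl
    rw [hmass] at hmean
    have hexp : (2 : ℝ) ^ (n * (q * (α - η) + X - 1)) ≤ 2 ^ (n * ((q - 1) * (x - η))) := by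
      apply Real.rpow_le_rpow_of_exponent_le one_le_two
      apply mul_le_mul_of_nonneg_left _ hn'.le
      linarith
    have hone : (1 : ℝ) ≤ 2 ^ (n * ((q - 1) * (x - η))) :=
      Real.one_le_rpow one_le_two (mul_nonneg hn'.le (mul_nonneg hq0.le (by linarith)))
    have h2q : (0 : ℝ) < 2 ^ q := Real.rpow_pos_of_pos two_pos q
    have hmean2 : (mean fun z => sphereMix n r l z ^ q) ≤
        (1 + 2 ^ q) * 2 ^ (n * ((q - 1) * (x - η))) := by
      nlinarith [mul_le_mul_of_nonneg_left hexp h2q.le]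
    have hge := one_le_mean_rpow hq.le hf0 hf1
    have hlog := Real.logb_le_logb_of_le one_lt_two (by linarith) hmean2
    rw [Real.logb_mul (by positivity) (by positivity),
      Real.logb_rpow two_pos (by norm_num)] at hlog
    rw [renyiEnt_eq hq hf0, div_le_iff₀ hn', one_div, inv_mul_le_iff₀ hq0]
    linarith
  · have hTf0 := noise_nonneg hε'.1 (by linarith [hε.2]) hf0
    have hpt : ∀ z : Cube n, A * noise ε (sphereInd n r) z ≤ noise ε (sphereMix n r l) z := by
      intro z
      rw [← noise_const_mul]
      refine noise_mono hε'.1 (by linarith [hε.2]) (fun w => ?_) z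
      rw [hval]
      linarith [hlmem.2]
    have hmean : A ^ 2 * (∑ z, noise ε (sphereInd n r) z ^ 2) / 2 ^ n ≤
        mean fun z => noise ε (sphereMix n r l) z ^ 2 := by
      rw [mean, Finset.mul_sum]
      refine div_le_div_of_nonneg_right (Finset.sum_le_sum fun z _ => ?_) (by positivity)
      rw [← mul_pow]
      exact pow_le_pow_left₀ (mul_nonneg hA0.le
        (noise_nonneg hε'.1 (by linarith [hε.2]) sphereInd_nonneg z)) (hpt z) 2
    have hlog := Real.logb_le_logb_of_le one_lt_two (by positivity) hmean
    rw [Real.logb_div (by positivity) (by positivity), Real.logb_mul (by positivity) hQ.ne',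
      Real.logb_pow, Real.logb_pow, Real.logb_self_eq_one one_lt_two, hA,
      Real.logb_rpow two_pos (by norm_num)] at hlog
    rw [renyiEnt_two hTf0, lt_div_iff₀ hn']
    push_cast at hlog
    have hsX : -η ≤ s * (X - β) := by
      have k := mul_le_mul_of_nonneg_left hX1.le (show 0 ≤ s by linarith)
      have k' := mul_le_of_le_one_left hη0.le hs1.le
      linarith
    have k1 := mul_le_mul_of_nonneg_left hsX hn'.le
    have k2 : (n : ℝ) * (8 * η) ≤ n * (psi q x ε - y) := mul_le_mul_of_nonneg_left hηy hn'.le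
    rw [hpsi] at k2
    have k3 : 0 < (n : ℝ) * η := by positivity
    linear_combination hlog + hlow + 2 * h2 + 2 * k1 + k2 + 2 * k3

end MrsGerber

theorem proposition1p1 (q : ℝ) (hq : 1 < q) :
    -- the function `ψ_{2,q}` is well defined
    (∀ ε ∈ Icc (0 : ℝ) (1 / 2), DifferentiableOn ℝ (MrsGerber.phi ε) (Icc 0 1)) ∧
    (∀ ε ∈ Ioc (0 : ℝ) (1 / 2), ∀ x ∈ Icc (0 : ℝ) 1, MrsGerber.phi' ε (1 - x) < 1 / q →
      ∃! α : ℝ, α ∈ Icc (0 : ℝ) 1 ∧ MrsGerber.phi' ε α = 1 / q) ∧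
    -- it is increasing and concave in its first argument
    (∀ ε ∈ Icc (0 : ℝ) (1 / 2), MonotoneOn (fun x => MrsGerber.psi q x ε) (Icc 0 1)) ∧
    (∀ ε ∈ Ico (0 : ℝ) (1 / 2), StrictMonoOn (fun x => MrsGerber.psi q x ε) (Icc 0 1)) ∧
    (∀ ε ∈ Icc (0 : ℝ) (1 / 2), ConcaveOn ℝ (Icc 0 1) (fun x => MrsGerber.psi q x ε)) ∧
    -- the inequality
    (∀ ε ∈ Icc (0 : ℝ) (1 / 2), ∀ n : ℕ, 0 < n → ∀ f : MrsGerber.Cube n → ℝ,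
      (∀ z, 0 ≤ f z) → MrsGerber.mean f = 1 →
        MrsGerber.renyiEnt q f / n ∈ Icc (0 : ℝ) 1 ∧
        MrsGerber.renyiEnt 2 (MrsGerber.noise ε f) / n ≤
          MrsGerber.psi q (MrsGerber.renyiEnt q f / n) ε) ∧
    -- tightness, attained by mixtures of the uniform distribution and a Hamming sphere
    (∀ x ∈ Ioo (0 : ℝ) 1, ∀ ε ∈ Ioo (0 : ℝ) (1 / 2), ∀ y < MrsGerber.psi q x ε,
      ∀ n₀ : ℕ, ∃ n : ℕ, n₀ ≤ n ∧ 0 < n ∧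
        ∃ f : MrsGerber.Cube n → ℝ,
          (∀ z, 0 ≤ f z) ∧ MrsGerber.mean f = 1 ∧
          (∃ r ≤ n, ∃ l ∈ Icc (0 : ℝ) 1, f = MrsGerber.sphereMix n r l) ∧
          MrsGerber.renyiEnt q f / n ≤ x ∧
          y < MrsGerber.renyiEnt 2 (MrsGerber.noise ε f) / n) := by
  refine ⟨fun ε hε => MrsGerber.differentiableOn_phi hε,
    fun ε hε x hx h => MrsGerber.existsUnique_phi'_eq hq hε hx h,
    fun ε hε => MrsGerber.psi_monotoneOn hq hε,
    fun ε hε => MrsGerber.psi_strictMonoOn hq hε,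
    fun ε hε => MrsGerber.psi_concaveOn hq hε,
    fun ε hε n hn f hf h1 => ⟨MrsGerber.renyiEnt_div_mem hn hq hf h1,
      MrsGerber.renyiEnt_noise_le hq hε hn hf h1⟩,
    fun x hx ε hε y hy n₀ => MrsGerber.exists_sphereMix hq hx hε hy n₀⟩
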